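/- Let $d\ge 3$ be an integer and let $T_d$ be the $d$-regular tree, i.e. the connected graph without cycles in which every vertex has exactly $d$ neighbours; let $V(T_d)$ be its vertex set. Let $M$ be a finite set (with the discrete $\sigma$-algebra). The group $\mathrm{Aut}(T_d)$ acts on vertex labelings by $(\gamma\cdot f)(v)=f(\gamma^{-1}v)$. A random labeling $Y=(Y_v)_{v\in V(T_d)}$ with values in $M^{V(T_d)}$ is called an $\mathrm{Aut}(T_d)$-factor of IID process if it has the distribution of $F(Z)$, where $Z=(Z_v)_{v\in V(T_d)}$ is a family of independent uniform $[0,1]$ random variables and $F\colon[0,1]^{V(T_d)}\to M^{V(T_d)}$ is a measurable map commuting with the action of $\mathrm{Aut}(T_d)$. Let $H$ denote Shannon entropy and $I(Y_u;Y_v)=H(Y_u)+H(Y_v)-H(Y_u,Y_v)$ mutual information. Then for every $\mathrm{Aut}(T_d)$-factor of IID process $Y$ and all vertices $u,v\in V(T_d)$ at distance $k\ge 0$, $$\frac{I(Y_u;Y_v)}{H(Y_v)}\le\begin{cases}\dfrac{2}{d(d-1)^l}&\text{if }k=2l+1\text{ is odd},\\[2mm]\dfrac{1}{(d-1)^l}&\text{if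 }k=2l\text{ is even}.\end{cases}$$ (If $H(Y_v)=0$, then also $I(Y_u;Y_v)=0$, and the quotient is read as $0$.) -/

import Mathlib

open MeasureTheory ProbabilityTheory

namespace FactorIID

/-- The natural action of an automorphism `γ` of a graph `T` on labelings of the vertices:
`(γ · f)(v) = f (γ⁻¹ v)`. -/
def autAct {V S : Type*} {T : SimpleGraph V} (γ : T ≃g T) (f : V → S) : V → S :=
  fun v => f (γ.symm v)

/-- An `Aut(T)`-factor map: a measurable map between spaces of vertex labelings
that commutes with the action of the full automorphism group of `T`. -/
structure IsAutFactor {V A B : Type*} [MeasurableSpace A] [MeasurableSpace B]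
    (T : SimpleGraph V) (F : (V → A) → (V → B)) : Prop where
  measurable : Measurable F
  equivariant : ∀ (γ : T ≃g T) (f : V → A), F (autAct γ f) = autAct γ (F f)

/-- The law of an IID family, indexed by `V`, of uniform `[0,1]` random variables. -/
noncomputable def iidUniform (V : Type*) : Measure (V → unitInterval) :=
  Measure.infinitePi fun _ => (volume : Measure unitInterval)

/-- The random labeling `Y` (defined on the probability space `(Ω, P)`) is an
`Aut(T)`-factor of IID process: it is distributed as `F(Z)`, where `Z` is an IID family of
uniform `[0,1]` labels on the vertices and `F` is an `Aut(T)`-factor map. -/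
def IsAutFactorOfIID {V Ω M : Type*} [MeasurableSpace Ω] [MeasurableSpace M]
    (T : SimpleGraph V) (P : Measure Ω) (Y : Ω → V → M) : Prop :=
  ∃ F : (V → unitInterval) → (V → M), IsAutFactor T F ∧ HasLaw Y ((iidUniform V).map F) P

/-- Shannon entropy (in nats) of a random variable with values in a finite set. -/
noncomputable def entropy {Ω S : Type*} [MeasurableSpace Ω] [Fintype S] [MeasurableSpace S]
    (P : Measure Ω) (X : Ω → S) : ℝ :=
  ∑ s : S, Real.negMulLog ((P.map X).real {s})

/-- Mutual information `I(X;X') = H(X) + H(X') - H(X,X')` of two random variables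
with values in finite sets. -/
noncomputable def mutualInfo {Ω S S' : Type*} [MeasurableSpace Ω]
    [Fintype S] [MeasurableSpace S] [Fintype S'] [MeasurableSpace S']
    (P : Measure Ω) (X : Ω → S) (X' : Ω → S') : ℝ :=
  entropy P X + entropy P X' - entropy P (fun ω => (X ω, X' ω))

end FactorIID

/-! For `k ≥ 1` let `s` be the size of a sphere of radius `k`. The core is the entropy inequality
`(2s - N) H(Y_u) ≤ s H(Y_u, Y_v)`, where `N` bounds `descentCount`. All `Y_v` have the same entropy,
so it says `s I(Y_u; Y_v) ≤ N H(Y_v)`; counting in the tree supplies `N`.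

Entropy is continuous and factors of IID are limits of block factors
(`exists_isBlockFactor_approx`), so `Y` may be taken to be a block factor. Reveal the label of each
vertex independently with probability `t`, and follow the mean of `pairSurplus`: the sum over `y` at
distance `k` from `o` of `H(Y_o, Y_y | S)`, minus `(2s - N) H(Y_o | S)`. At `t = 1` everything is
determined and the surplus is zero. If it is nonincreasing in `t`, then it is nonnegative at `t =
0`, which is the inequality.

By Russo's formula (`hasDerivAt_subsetMean`) the derivative adds up the effects on the surplus at
`o` of revealing each `w`. An automorphism exchanging `o` and `w` (`exists_aut_of_dist_eq`) turns
this into the total effect, on the surpluses at all `w`, of revealing the single label at `o`.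

Let `f w` be the information about `Y_w` gained from that label. A pair gains at least `max (f w) (f
y)` (`condEntropy_sub_insert_le`), hence at least the value at the endpoint nearer to `o`. In the
sum of `f w + f y` over ordered pairs each value occurs `2s` times, and the values discarded account
for at most `N` of these. So the pairs gain at least `2s - N` times the sum of `f` (`le_sum_max`),
and the surplus cannot grow. -/

namespace FactorIID

/-! ### Distances and counting in regular trees. -/

section Tree

variable {V : Type*} {T : SimpleGraph V}

/-- A vertex on a geodesic of a tree from `x` to `o` lies on a geodesic from `x` to `y` or on one
from `y` to `o`. -/
theorem dist_add_dist_of_isTree (hT : T.IsTree) {x o w : V}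
    (hw : T.dist x w + T.dist w o = T.dist x o) (y : V) :
    T.dist x w + T.dist w y = T.dist x y ∨ T.dist y w + T.dist w o = T.dist y o := by
  classical
  have hc := hT.1
  obtain ⟨p, hp⟩ := hc.exists_walk_length_eq_dist x w
  obtain ⟨q, hq⟩ := hc.exists_walk_length_eq_dist w o
  obtain ⟨r, hr⟩ := hc.exists_walk_length_eq_dist x y
  obtain ⟨s, hs⟩ := hc.exists_walk_length_eq_dist y o
  have h1 : (p.append q).IsPath := by
    apply SimpleGraph.Walk.isPath_of_length_eq_dist
    rw [SimpleGraph.Walk.length_append]; omega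
  -- Paths in a tree are unique, so loop-erasing the walk through `y` gives the geodesic through
  -- `w`; hence `w` lies on one of the two halves.
  have h2 : (r.append s).bypass = p.append q :=
    (hT.existsUnique_path x o).unique (SimpleGraph.Walk.bypass_isPath _) h1
  have h3 : w ∈ (r.append s).support := by
    apply SimpleGraph.Walk.support_bypass_subset_support
    rw [h2]; simp
  rw [SimpleGraph.Walk.mem_support_append_iff] at h3
  rcases h3 with h | h
  · left
    have e := congrArg SimpleGraph.Walk.length (r.take_spec h)
    rw [SimpleGraph.Walk.length_append] at e
    have := SimpleGraph.dist_le (r.takeUntil w h)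
    have := SimpleGraph.dist_le (r.dropUntil w h)
    have := hc.dist_triangle (u := x) (v := w) (w := y)
    omega
  · right
    have e := congrArg SimpleGraph.Walk.length (s.take_spec h)
    rw [SimpleGraph.Walk.length_append] at e
    have := SimpleGraph.dist_le (s.takeUntil w h)
    have := SimpleGraph.dist_le (s.dropUntil w h)
    have := hc.dist_triangle (u := y) (v := w) (w := o)
    omega

theorem exists_dist_eq_of_le (hc : T.Connected) {x o : V} {j : ℕ} (hj : j ≤ T.dist x o) :
    ∃ w, T.dist x w = j ∧ j + T.dist w o = T.dist x o := by
  obtain ⟨p, hp⟩ := hc.exists_walk_length_eq_dist x o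
  have h1 := SimpleGraph.dist_le (p.take j)
  have h2 := SimpleGraph.dist_le (p.drop j)
  have h3 : (p.take j).length ≤ j := by simp [SimpleGraph.Walk.take_length]
  have h4 : (p.drop j).length = p.length - j := by simp
  have := hc.dist_triangle (u := x) (v := p.getVert j) (w := o)
  exact ⟨p.getVert j, by omega, by omega⟩

theorem exists_adj_dist_eq (hc : T.Connected) {x y : V} {n : ℕ} (h : T.dist x y = n + 1) :
    ∃ z, T.Adj x z ∧ T.dist z y = n := by
  obtain ⟨w, h1, h2⟩ := exists_dist_eq_of_le hc (x := x) (o := y) (j := 1) (by omega)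
  exact ⟨w, SimpleGraph.dist_eq_one_iff_adj.1 h1, by omega⟩

/-- In a tree, the neighbor of `v` that is closer to `x` is unique. -/
theorem eq_of_adj_of_dist_lt (hT : T.IsTree) {x v z z' : V} (hz : T.Adj v z) (hz' : T.Adj v z')
    (h : T.dist x z + 1 = T.dist x v) (h' : T.dist x z' + 1 = T.dist x v) : z = z' := by
  have a := SimpleGraph.dist_eq_one_iff_adj.2 hz
  have a' := SimpleGraph.dist_eq_one_iff_adj.2 hz'
  rcases dist_add_dist_of_isTree hT (x := v) (w := z) (o := x)
    (by rw [T.dist_comm (u := z), T.dist_comm (u := v) (v := x)]; omega) z' with e | e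
  · exact hT.1.dist_eq_zero_iff.1 (by omega)
  · rw [T.dist_comm (u := z) (v := x), T.dist_comm (u := z') (v := x), T.dist_comm (u := z')] at e
    exact hT.1.dist_eq_zero_iff.1 (by omega)

/-- A tree is bipartite: each edge changes the distance to `o` by exactly one. Parity sharpens the
inequalities between distances in the two bounds on `descentCount`. -/
theorem dist_mod_two_of_isTree (hT : T.IsTree) (o x y : V) :
    (T.dist x y + T.dist o x + T.dist o y) % 2 = 0 := by
  generalize hn : T.dist x y = n
  induction n generalizing x with
  | zero => rw [hT.1.dist_eq_zero_iff] at hn; subst hn; omega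
  | succ n ih =>
    obtain ⟨z, hz, hzy⟩ := exists_adj_dist_eq hT.1 hn
    have := ih z hzy
    have := hT.dist_eq_dist_add_one_of_adj o hz
    omega

section Finite

variable [T.LocallyFinite]

theorem finite_dist_le (hc : T.Connected) (x : V) (n : ℕ) : {y | T.dist x y ≤ n}.Finite := by
  induction n with
  | zero =>
    refine (Set.finite_singleton x).subset fun y hy => ?_
    exact (hc.dist_eq_zero_iff.1 (Nat.le_zero.1 hy)).symm
  | succ n ih =>
    refine (ih.union (ih.biUnion fun z _ => (T.neighborFinset z).finite_toSet)).subset ?_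
    intro y hy
    rcases Nat.lt_or_ge n (T.dist x y) with h | h
    · right
      obtain ⟨z, hz, hzy⟩ := exists_adj_dist_eq hc (x := y) (y := x) (n := n)
        (by rw [T.dist_comm]; exact le_antisymm hy h)
      simp only [Set.mem_iUnion, Set.mem_ofPred_eq]
      exact ⟨z, by rw [T.dist_comm]; omega, by simpa using hz.symm⟩
    · exact Or.inl h

open Classical in
/-- The closed ball of radius `n` around `x`, as a finite set (empty if it is infinite). -/
noncomputable def cball (T : SimpleGraph V) (x : V) (n : ℕ) : Finset V :=
  if h : {y | T.dist x y ≤ n}.Finite then h.toFinset else ∅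

/-- The sphere of radius `n` around `x`. -/
noncomputable def sphere (T : SimpleGraph V) (x : V) (n : ℕ) : Finset V :=
  (cball T x n).filter fun y => T.dist x y = n

/-- The vertices at distance `n` from `w` that are further away from `w'`. -/
noncomputable def branch (T : SimpleGraph V) (w' w : V) (n : ℕ) : Finset V :=
  (sphere T w n).filter fun y => T.dist w' y = n + 1

theorem mem_cball (hc : T.Connected) {x y : V} {n : ℕ} : y ∈ cball T x n ↔ T.dist x y ≤ n := by
  rw [cball, dif_pos (finite_dist_le hc x n)]; simp

theorem mem_sphere (hc : T.Connected) {x y : V} {n : ℕ} :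
    y ∈ sphere T x n ↔ T.dist x y = n := by
  rw [sphere, Finset.mem_filter, mem_cball hc]; omega

theorem mem_branch (hc : T.Connected) {w' w y : V} {n : ℕ} :
    y ∈ branch T w' w n ↔ T.dist w y = n ∧ T.dist w' y = n + 1 := by
  rw [branch, Finset.mem_filter, mem_sphere hc]

theorem disjoint_branch (hT : T.IsTree) {w z z' : V} (hz : T.Adj w z) (hz' : T.Adj w z')
    (hne : z ≠ z') (n : ℕ) : Disjoint (branch T w z n) (branch T w z' n) := by
  rw [Finset.disjoint_left]
  intro y hy hy'
  rw [mem_branch hT.1] at hy hy'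
  refine hne (eq_of_adj_of_dist_lt hT (x := y) hz hz' ?_ ?_) <;>
  · rw [T.dist_comm, T.dist_comm (u := y)]; omega

theorem card_branch (hT : T.IsTree) {d : ℕ} (hreg : T.IsRegularOfDegree d) {w' w : V}
    (h : T.Adj w w') (n : ℕ) : (branch T w' w n).card = (d - 1) ^ n := by
  classical
  induction n generalizing w' w with
  | zero =>
    have : branch T w' w 0 = {w} := by
      ext y
      rw [mem_branch hT.1, Finset.mem_singleton, hT.1.dist_eq_zero_iff]
      refine ⟨fun h => h.1.symm, ?_⟩
      rintro rfl
      exact ⟨rfl, SimpleGraph.dist_eq_one_iff_adj.2 h.symm⟩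
    rw [this]; simp
  | succ n ih =>
    have e : branch T w' w (n + 1) =
        ((T.neighborFinset w).erase w').biUnion fun z => branch T w z n := by
      ext y
      simp only [Finset.mem_biUnion, Finset.mem_erase, SimpleGraph.mem_neighborFinset,
        mem_branch hT.1]
      constructor
      · rintro ⟨h1, h2⟩
        obtain ⟨z, hz, hzy⟩ := exists_adj_dist_eq hT.1 h1
        refine ⟨z, ⟨?_, hz⟩, hzy, h1⟩
        rintro rfl; omega
      · rintro ⟨z, ⟨hne, hz⟩, h1, h2⟩
        refine ⟨h2, ?_⟩
        rcases hT.dist_eq_dist_add_one_of_adj y h with e | e <;>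
          rw [T.dist_comm (u := y), T.dist_comm (u := y)] at e
        · exact absurd (eq_of_adj_of_dist_lt hT (x := y) hz h
            (by rw [T.dist_comm, T.dist_comm (u := y)]; omega)
            (by rw [T.dist_comm, T.dist_comm (u := y)]; omega)) hne
        · omega
    rw [e, Finset.card_biUnion]
    · rw [Finset.sum_congr rfl (g := fun _ => (d - 1) ^ n)]
      · rw [Finset.sum_const, Finset.card_erase_of_mem (by simpa using h),
          SimpleGraph.card_neighborFinset_eq_degree, hreg w, smul_eq_mul, pow_succ, mul_comm]
      · intro z hz
        simp only [Finset.mem_erase, SimpleGraph.mem_neighborFinset] at hz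
        exact ih hz.2.symm
    · intro z hz z' hz' hne
      simp only [Finset.mem_coe, Finset.mem_erase, SimpleGraph.mem_neighborFinset] at hz hz'
      exact disjoint_branch hT hz.2 hz'.2 hne n

theorem card_sphere_succ (hT : T.IsTree) {d : ℕ} (hreg : T.IsRegularOfDegree d) (x : V) (n : ℕ) :
    (sphere T x (n + 1)).card = d * (d - 1) ^ n := by
  classical
  have e : sphere T x (n + 1) = (T.neighborFinset x).biUnion fun z => branch T x z n := by
    ext y
    simp only [Finset.mem_biUnion, SimpleGraph.mem_neighborFinset, mem_branch hT.1,
      mem_sphere hT.1]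
    constructor
    · intro h1
      obtain ⟨z, hz, hzy⟩ := exists_adj_dist_eq hT.1 h1
      exact ⟨z, hz, hzy, h1⟩
    · rintro ⟨z, hz, h1, h2⟩
      exact h2
  rw [e, Finset.card_biUnion]
  · rw [Finset.sum_congr rfl (g := fun _ => (d - 1) ^ n)]
    · rw [Finset.sum_const, SimpleGraph.card_neighborFinset_eq_degree, hreg x, smul_eq_mul]
    · intro z hz
      rw [SimpleGraph.mem_neighborFinset] at hz
      exact card_branch hT hreg hz.symm n
  · intro z hz z' hz' hne
    simp only [Finset.mem_coe, SimpleGraph.mem_neighborFinset] at hz hz'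
    exact disjoint_branch hT hz hz' hne n

/-- The vertices `y` at distance `j + n` from `x` whose distance from a root `o` is at most
`d(x, o) - (j - n)` all lie behind the vertex at distance `j` from `x` on the way to `o`. -/
theorem card_sphere_filter_le (hT : T.IsTree) {d : ℕ} (hreg : T.IsRegularOfDegree d)
    (o x : V) {j n : ℕ} (hj : 1 ≤ j) :
    ((sphere T x (j + n)).filter fun y => T.dist o y + j ≤ T.dist o x + n).card ≤
      (d - 1) ^ n := by
  classical
  rcases Finset.eq_empty_or_nonempty
    ((sphere T x (j + n)).filter fun y => T.dist o y + j ≤ T.dist o x + n) with h0 | ⟨y₀, hy₀⟩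
  · rw [h0]; simp
  -- Going from `x` to `y₀` through `o` gives `j + n ≤ 2 d(o, x) + n - j`, so the geodesic to `o` is
  -- long enough to contain a vertex at distance `j`.
  have hox : j ≤ T.dist x o := by
    rw [Finset.mem_filter, mem_sphere hT.1] at hy₀
    have := hT.1.dist_triangle (u := x) (v := o) (w := y₀)
    rw [T.dist_comm (u := x) (v := o)] at this ⊢
    omega
  obtain ⟨w, hxw, hwo⟩ := exists_dist_eq_of_le hT.1 hox
  obtain ⟨j, rfl⟩ : ∃ i, j = i + 1 := ⟨j - 1, by omega⟩
  obtain ⟨w', hww', hw'⟩ := exists_adj_dist_eq hT.1 (x := w) (y := x) (n := j)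
    (by rw [T.dist_comm]; exact hxw)
  rw [← card_branch hT hreg hww' n]
  apply Finset.card_le_card
  intro y hy
  rw [Finset.mem_filter, mem_sphere hT.1] at hy
  rw [mem_branch hT.1]
  rw [T.dist_comm (u := o), T.dist_comm (u := o)] at hy
  rw [T.dist_comm] at hw'
  have t1 := hT.1.dist_triangle (u := x) (v := w) (w := y)
  have t2 := hT.1.dist_triangle (u := x) (v := w') (w := y)
  have t3 := hT.1.dist_triangle (u := w') (v := w) (w := y)
  have t4 := SimpleGraph.dist_eq_one_iff_adj.2 hww'.symm
  -- Either alternative forces `d(w, y) = n`; the triangle inequalities then give `d(w', y) = n +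
  -- 1`.
  have key := dist_add_dist_of_isTree hT (x := x) (o := o) (w := w) (by omega) y
  rw [T.dist_comm (u := y) (v := w)] at key
  rcases key with e | e <;> constructor <;> omega

/-- Twice the number of vertices at distance `k` from `x` that are closer to the root than `x`,
plus the number of those equally close. -/
noncomputable def descentCount (T : SimpleGraph V) (o x : V) (k : ℕ) : ℕ :=
  ((sphere T x k).filter fun y => T.dist o y ≤ T.dist o x).card +
    ((sphere T x k).filter fun y => T.dist o y < T.dist o x).card

/-- At odd distance ties are impossible, so both counts are covered by the split `(l + 1) + l`. -/
theorem descentCount_odd_le (hT : T.IsTree) {d : ℕ} (hreg : T.IsRegularOfDegree d)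
    (o x : V) (l : ℕ) : descentCount T o x (2 * l + 1) ≤ 2 * (d - 1) ^ l := by
  have h := card_sphere_filter_le hT hreg o x (j := l + 1) (n := l) (by omega)
  have e : l + 1 + l = 2 * l + 1 := by omega
  rw [e] at h
  have h1 : ((sphere T x (2 * l + 1)).filter fun y => T.dist o y ≤ T.dist o x).card ≤
      (d - 1) ^ l := by
    refine le_trans (Finset.card_le_card fun y hy => ?_) h
    rw [Finset.mem_filter, mem_sphere hT.1] at hy ⊢
    have := dist_mod_two_of_isTree hT o x y
    omega
  have h2 : ((sphere T x (2 * l + 1)).filter fun y => T.dist o y < T.dist o x).card ≤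
      (d - 1) ^ l := by
    refine le_trans (Finset.card_le_card fun y hy => ?_) h
    rw [Finset.mem_filter] at hy ⊢
    exact ⟨hy.1, by omega⟩
  rw [descentCount]; omega

/-- Ties do occur here and need the split `(l + 1) + (l + 1)`. By parity, a strictly closer vertex
is closer by at least two, which allows the split `(l + 2) + l`. -/
theorem descentCount_even_le (hT : T.IsTree) {d : ℕ} (hreg : T.IsRegularOfDegree d)
    (o x : V) (l : ℕ) :
    descentCount T o x (2 * (l + 1)) ≤ (d - 1) ^ (l + 1) + (d - 1) ^ l := by
  have h := card_sphere_filter_le hT hreg o x (j := l + 1) (n := l + 1) (by omega)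
  have h' := card_sphere_filter_le hT hreg o x (j := l + 2) (n := l) (by omega)
  have e : l + 1 + (l + 1) = 2 * (l + 1) := by omega
  have e' : l + 2 + l = 2 * (l + 1) := by omega
  rw [e] at h
  rw [e'] at h'
  have h1 : ((sphere T x (2 * (l + 1))).filter fun y => T.dist o y ≤ T.dist o x).card ≤
      (d - 1) ^ (l + 1) := by
    refine le_trans (Finset.card_le_card fun y hy => ?_) h
    rw [Finset.mem_filter] at hy ⊢
    exact ⟨hy.1, by omega⟩
  have h2 : ((sphere T x (2 * (l + 1))).filter fun y => T.dist o y < T.dist o x).card ≤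
      (d - 1) ^ l := by
    refine le_trans (Finset.card_le_card fun y hy => ?_) h'
    rw [Finset.mem_filter, mem_sphere hT.1] at hy ⊢
    have := dist_mod_two_of_isTree hT o x y
    omega
  rw [descentCount]; omega

/-- Double counting over pairs at distance `k`. -/
theorem sum_sphere_comm (hc : T.Connected) (k : ℕ) (A : Finset V) (f : V → V → ℝ)
    (hf : ∀ w y, f w y ≠ 0 → w ∈ A ∧ y ∈ A) :
    ∑ w ∈ A, ∑ y ∈ sphere T w k, f w y = ∑ y ∈ A, ∑ w ∈ sphere T y k, f w y := by
  classical
  have h1 : ∀ w ∈ A, ∑ y ∈ sphere T w k, f w y =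
      ∑ y ∈ (sphere T w k).filter (· ∈ A), f w y := by
    intro w _
    symm
    apply Finset.sum_filter_of_ne
    intro y _ h
    exact (hf w y h).2
  have h2 : ∀ y ∈ A, ∑ w ∈ sphere T y k, f w y =
      ∑ w ∈ (sphere T y k).filter (· ∈ A), f w y := by
    intro y _
    symm
    apply Finset.sum_filter_of_ne
    intro w _ h
    exact (hf w y h).1
  rw [Finset.sum_congr rfl h1, Finset.sum_congr rfl h2]
  apply Finset.sum_comm'
  intro w y
  simp only [Finset.mem_filter, mem_sphere hc, T.dist_comm (u := w)]
  tauto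

/-- If `f ≥ 0` vanishes at all vertices within distance `k` of the complement of `A`, then the sum
of `max (f w) (f y)` over pairs at distance `k` is bounded below by a multiple of the sum of `f`. -/
theorem le_sum_max (hT : T.IsTree) {d : ℕ} (hreg : T.IsRegularOfDegree d) (o : V) (k N : ℕ)
    (hN : ∀ x, descentCount T o x (k + 1) ≤ N) (A : Finset V) (f : V → ℝ) (hf0 : ∀ x, 0 ≤ f x)
    (hf : ∀ x y, f x ≠ 0 → T.dist x y ≤ k + 1 → y ∈ A) :
    (2 * (d * (d - 1 : ℕ) ^ k : ℝ) - N) * ∑ w ∈ A, f w ≤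
      ∑ w ∈ A, ∑ y ∈ sphere T w (k + 1), max (f w) (f y) := by
  classical
  have hc := hT.1
  -- Keep the value at the endpoint nearer to `o`, at `y` in case of a tie, and discard the other.
  have hmax : ∀ w y, f w + f y - ((if T.dist o y ≤ T.dist o w then f w else 0) +
      (if T.dist o w < T.dist o y then f y else 0)) ≤ max (f w) (f y) := by
    intro w y
    rcases le_or_gt (T.dist o y) (T.dist o w) with h | h
    · rw [if_pos h, if_neg (by omega)]
      have := le_max_right (f w) (f y); linarith
    · rw [if_neg (by omega), if_pos h]
      have := le_max_left (f w) (f y); linarith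
  -- Regroup terms by the vertex whose value they carry. By `hf`, a nonzero `f y` has all its
  -- partners in `A`, so restricting to `A` loses nothing.
  have swap : ∀ (P : V → V → Prop) [∀ w y, Decidable (P w y)],
      ∑ w ∈ A, ∑ y ∈ sphere T w (k + 1), (if P w y then f y else 0) =
        ∑ y ∈ A, ∑ w ∈ sphere T y (k + 1), (if P w y then f y else 0) := by
    intro P _
    have e : ∀ (w y : V), y ∈ sphere T w (k + 1) → (if P w y then f y else 0) =
        if T.dist w y = k + 1 ∧ P w y then f y else 0 := by
      intro w y h
      rw [mem_sphere hc] at h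
      simp [h]
    have e' : ∀ (w y : V), w ∈ sphere T y (k + 1) → (if P w y then f y else 0) =
        if T.dist w y = k + 1 ∧ P w y then f y else 0 := by
      intro w y h
      rw [mem_sphere hc, T.dist_comm] at h
      simp [h]
    rw [Finset.sum_congr rfl fun w _ => Finset.sum_congr rfl (e w),
      Finset.sum_congr rfl fun y _ => Finset.sum_congr rfl fun w => e' w y]
    apply sum_sphere_comm hc
    intro w y h
    simp only [ne_eq, ite_eq_right_iff, not_forall] at h
    obtain ⟨⟨h1, _⟩, h2⟩ := h
    exact ⟨hf y w h2 (by rw [T.dist_comm]; omega), hf y y h2 (by simp)⟩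
  have hS : ∀ x, ((sphere T x (k + 1)).card : ℝ) = d * (d - 1 : ℕ) ^ k := by
    intro x; rw [card_sphere_succ hT hreg]; push_cast; rfl
  have s1 : ∑ w ∈ A, ∑ y ∈ sphere T w (k + 1), f w = (d * (d - 1 : ℕ) ^ k : ℝ) * ∑ w ∈ A, f w := by
    rw [Finset.mul_sum]
    exact Finset.sum_congr rfl fun w _ => by rw [Finset.sum_const, nsmul_eq_mul, hS]
  have s2 : ∑ w ∈ A, ∑ y ∈ sphere T w (k + 1), f y = (d * (d - 1 : ℕ) ^ k : ℝ) * ∑ w ∈ A, f w := by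
    have := swap (fun _ _ => True)
    simp only [if_true] at this
    rw [this, ← s1]
  -- After regrouping, `f w` is discarded exactly `descentCount T o w (k + 1)` times.
  have s3 : ∑ w ∈ A, ∑ y ∈ sphere T w (k + 1), ((if T.dist o y ≤ T.dist o w then f w else 0) +
      (if T.dist o w < T.dist o y then f y else 0)) ≤ N * ∑ w ∈ A, f w := by
    simp only [Finset.sum_add_distrib]
    rw [swap (fun w y => T.dist o w < T.dist o y), ← Finset.sum_add_distrib, Finset.mul_sum]
    apply Finset.sum_le_sum
    intro w _
    rw [← Finset.sum_filter, ← Finset.sum_filter, Finset.sum_const, Finset.sum_const,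
      nsmul_eq_mul, nsmul_eq_mul, ← add_mul]
    refine mul_le_mul_of_nonneg_right ?_ (hf0 w)
    exact_mod_cast hN w
  calc (2 * (d * (d - 1 : ℕ) ^ k : ℝ) - N) * ∑ w ∈ A, f w
      ≤ ∑ w ∈ A, ∑ y ∈ sphere T w (k + 1), (f w + f y -
        ((if T.dist o y ≤ T.dist o w then f w else 0) +
        (if T.dist o w < T.dist o y then f y else 0))) := by
        simp only [Finset.sum_sub_distrib]
        rw [Finset.sum_congr rfl fun w _ => Finset.sum_add_distrib, Finset.sum_add_distrib, s1, s2]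
        linarith
    _ ≤ _ := Finset.sum_le_sum fun w _ => Finset.sum_le_sum fun y _ => hmax w y

end Finite

end Tree

/-! ### Automorphisms of regular trees and distance-transitivity. -/

section Automorphism

variable {V : Type*} {T : SimpleGraph V}

theorem exists_bijOn_of_card_eq {α : Type*} {s t : Finset α} (h : s.card = t.card)
    {a b : α} (ha : a ∈ s) (hb : b ∈ t) : ∃ f : α → α, Set.BijOn f s t ∧ f a = b := by
  classical
  have : Nonempty α := ⟨a⟩
  obtain ⟨f, hf⟩ := s.finite_toSet.exists_bijOn_of_encard_eq (t := (t : Set α))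
    (by rw [Set.encard_coe_eq_coe_finsetCard, Set.encard_coe_eq_coe_finsetCard, h])
  exact ⟨Equiv.swap (f a) b ∘ f, (Equiv.bijOn_swap (hf.mapsTo ha) hb).comp hf, by simp⟩

theorem dist_map (hc : T.Connected) (γ : T ≃g T) (x y : V) :
    T.dist (γ x) (γ y) = T.dist x y := by
  have key : ∀ (δ : T ≃g T) (a b : V), T.dist (δ a) (δ b) ≤ T.dist a b := by
    intro δ a b
    obtain ⟨p, hp⟩ := hc.exists_walk_length_eq_dist a b
    rw [← hp, ← SimpleGraph.Walk.length_map δ.toHom p]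
    exact SimpleGraph.dist_le _
  refine le_antisymm (key γ x y) ?_
  simpa using key γ.symm (γ x) (γ y)

variable [T.LocallyFinite]

/-- The neighbors of `v` that are further away from `x` than `v` is. -/
noncomputable def children (T : SimpleGraph V) [T.LocallyFinite] (x v : V) : Finset V :=
  (T.neighborFinset v).filter fun z => T.dist x z = T.dist x v + 1

theorem mem_children {x v z : V} :
    z ∈ children T x v ↔ T.Adj v z ∧ T.dist x z = T.dist x v + 1 := by
  rw [children, Finset.mem_filter, SimpleGraph.mem_neighborFinset]

theorem card_children (hT : T.IsTree) {d : ℕ} (hreg : T.IsRegularOfDegree d) (x v : V) :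
    (children T x v).card = if T.dist x v = 0 then d else d - 1 := by
  classical
  split_ifs with h
  · rw [← hreg v, ← SimpleGraph.card_neighborFinset_eq_degree, children, Finset.filter_true_of_mem]
    intro z hz
    rw [SimpleGraph.mem_neighborFinset] at hz
    have := hT.dist_eq_dist_add_one_of_adj x hz
    omega
  · obtain ⟨p, hp, hpx⟩ := exists_adj_dist_eq hT.1 (x := v) (y := x) (n := T.dist x v - 1)
      (by rw [T.dist_comm]; omega)
    rw [T.dist_comm] at hpx
    have : children T x v = (T.neighborFinset v).erase p := by
      ext z
      rw [mem_children, Finset.mem_erase, SimpleGraph.mem_neighborFinset, and_comm]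
      refine and_congr_left fun hz => ⟨?_, fun hne => ?_⟩
      · rintro h rfl; omega
      · rcases hT.dist_eq_dist_add_one_of_adj x hz with e | e
        · exact absurd (eq_of_adj_of_dist_lt hT hz hp e.symm (by omega)) hne
        · exact e
    rw [this, Finset.card_erase_of_mem (by simpa using hp),
      SimpleGraph.card_neighborFinset_eq_degree, hreg v]

/-- One level of the construction in `exists_aut_of_dist_eq`: vertices of equal depth have equally
many children. The last clause steers the geodesic to `y` onto the one to `y'`; at most one child
lies on it, so it suffices to prescribe one image. -/
theorem exists_bijOn_children (hT : T.IsTree) {d : ℕ} (hreg : T.IsRegularOfDegree d)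
    {x y x' y' : V} (hd : T.dist x y = T.dist x' y') {v v' : V} (hv : T.dist x v = T.dist x' v') :
    ∃ f : V → V, Set.BijOn f (children T x v) (children T x' v') ∧
      (T.dist x' v' + T.dist v' y' = T.dist x' y' → ∀ z ∈ children T x v,
        T.dist x z + T.dist z y = T.dist x y →
        T.dist x' (f z) + T.dist (f z) y' = T.dist x' y') := by
  classical
  have hcard : (children T x v).card = (children T x' v').card := by
    rw [card_children hT hreg, card_children hT hreg, hv]
  by_cases h : T.dist x' v' + T.dist v' y' = T.dist x' y' ∧
      ∃ z ∈ children T x v, T.dist x z + T.dist z y = T.dist x y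
  · obtain ⟨h1, z, hz, h2⟩ := h
    have hz' := hz
    rw [mem_children] at hz'
    obtain ⟨z₁, ha, hz₁⟩ := exists_adj_dist_eq hT.1 (x := v') (y := y') (n := T.dist v' y' - 1)
      (by omega)
    have t1 := hT.1.dist_triangle (u := x') (v := z₁) (w := y')
    have t2 := hT.dist_eq_dist_add_one_of_adj x' ha
    obtain ⟨f, hf, hfz⟩ := exists_bijOn_of_card_eq hcard hz (mem_children.2 ⟨ha, by omega⟩)
    refine ⟨f, hf, fun _ z₂ hz₂ h3 => ?_⟩
    rw [mem_children] at hz₂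
    have : z₂ = z := by
      have t3 := hT.1.dist_triangle (u := x) (v := v) (w := y)
      have t4 := hT.dist_eq_dist_add_one_of_adj y hz'.1
      have t5 := hT.dist_eq_dist_add_one_of_adj y hz₂.1
      simp only [T.dist_comm (u := y)] at t4 t5
      refine eq_of_adj_of_dist_lt hT (x := y) hz₂.1 hz'.1 ?_ ?_ <;>
        simp only [T.dist_comm (u := y)] <;> omega
    rw [this, hfz]
    omega
  · have : Nonempty V := ⟨x⟩
    obtain ⟨f, hf⟩ := (children T x v).finite_toSet.exists_bijOn_of_encard_eq
      (t := (children T x' v' : Set V))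
      (by rw [Set.encard_coe_eq_coe_finsetCard, Set.encard_coe_eq_coe_finsetCard, hcard])
    exact ⟨f, hf, fun h1 z hz h2 => absurd ⟨h1, z, hz, h2⟩ h⟩

/-- Regular trees are distance-transitive. -/
theorem exists_aut_of_dist_eq (hT : T.IsTree) {d : ℕ} (hreg : T.IsRegularOfDegree d)
    {x y x' y' : V} (hd : T.dist x y = T.dist x' y') : ∃ γ : T ≃g T, γ x = x' ∧ γ y = y' := by
  classical
  have hc := hT.1
  choose! E hE hE' using fun v v' (hv : T.dist x v = T.dist x' v') =>
    exists_bijOn_children hT hreg hd hv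
  have hpar : ∀ z, ∃ p, T.dist x z ≠ 0 → T.Adj z p ∧ T.dist x p + 1 = T.dist x z := by
    intro z
    by_cases h : T.dist x z = 0
    · exact ⟨z, fun h' => absurd h h'⟩
    · obtain ⟨p, hp, hpx⟩ := exists_adj_dist_eq hc (x := z) (y := x) (n := T.dist x z - 1)
        (by rw [T.dist_comm]; omega)
      rw [T.dist_comm] at hpx
      exact ⟨p, fun _ => ⟨hp, by omega⟩⟩
  choose par hpar using hpar
  -- Recursion on depth: `z` goes where the bijection between the children of its parent and those
  -- of the parent's image sends it.
  let F : ℕ → V → V := fun n => Nat.rec (fun _ => x') (fun _ g z => E (par z) (g (par z)) z) n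
  let f : V → V := fun z => F (T.dist x z) z
  have f_x : f x = x' := by simp [f, F]
  have f_step : ∀ z, T.dist x z ≠ 0 → f z = E (par z) (f (par z)) z := by
    intro z hz
    have h := (hpar z hz).2
    change F (T.dist x z) z = E (par z) (F (T.dist x (par z)) (par z)) z
    rw [← h]
  have mem_par : ∀ z, T.dist x z ≠ 0 → z ∈ children T x (par z) := fun z hz =>
    mem_children.2 ⟨(hpar z hz).1.symm, (hpar z hz).2.symm⟩
  have f_dist : ∀ n z, T.dist x z = n → T.dist x' (f z) = n := by
    intro n
    induction n with
    | zero =>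
      intro z hz
      obtain rfl := hc.dist_eq_zero_iff.1 hz
      rw [f_x]; simp
    | succ n ih =>
      intro z hz
      have h0 : T.dist x z ≠ 0 := by omega
      have h1 := hpar z h0
      have h2 := ih (par z) (by omega)
      have h3 := (hE (par z) (f (par z)) (by omega)).mapsTo (mem_par z h0)
      rw [Finset.mem_coe, mem_children, ← f_step z h0] at h3
      omega
  have f_dist' : ∀ z, T.dist x z = T.dist x' (f z) := fun z => (f_dist _ z rfl).symm
  have f_mem : ∀ z, T.dist x z ≠ 0 → f z ∈ children T x' (f (par z)) := by
    intro z h0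
    rw [f_step z h0]
    exact (hE (par z) (f (par z)) (f_dist' _)).mapsTo (mem_par z h0)
  have par_unique : ∀ p z, T.Adj p z → T.dist x z = T.dist x p + 1 → p = par z := by
    intro p z h1 h2
    exact eq_of_adj_of_dist_lt hT h1.symm (hpar z (by omega)).1 h2.symm (hpar z (by omega)).2
  have f_adj : ∀ a b, T.Adj a b → T.dist x b = T.dist x a + 1 → T.Adj (f a) (f b) := by
    intro a b h1 h2
    rw [par_unique a b h1 h2]
    exact (mem_children.1 (f_mem b (by omega))).1
  have f_inj : ∀ n a b, T.dist x a = n → f a = f b → a = b := by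
    intro n
    induction n with
    | zero =>
      intro a b ha hab
      have := f_dist' a
      have := f_dist' b
      rw [← hab] at this
      rw [← hc.dist_eq_zero_iff.1 ha, hc.dist_eq_zero_iff.1 (show T.dist x b = 0 by omega)]
    | succ n ih =>
      intro a b ha hab
      have h1 := f_dist' a
      have h2 := f_dist' b
      rw [← hab] at h2
      have ha0 : T.dist x a ≠ 0 := by omega
      have hb0 : T.dist x b ≠ 0 := by omega
      have h3 := mem_children.1 (f_mem a ha0)
      have h4 := mem_children.1 (f_mem b hb0)
      rw [← hab] at h4
      have h5 : f (par a) = f (par b) :=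
        eq_of_adj_of_dist_lt hT h3.1.symm h4.1.symm h3.2.symm h4.2.symm
      have h6 : par a = par b := ih _ _ (by have := (hpar a ha0).2; omega) h5
      rw [f_step a ha0, f_step b hb0, ← h6] at hab
      refine (hE (par a) (f (par a)) (f_dist' _)).injOn (mem_par a ha0) ?_ hab
      rw [h6]
      exact mem_par b hb0
  have f_surj : ∀ n b, T.dist x' b = n → ∃ a, f a = b := by
    intro n
    induction n with
    | zero => exact fun b hb => ⟨x, by rw [f_x, hc.dist_eq_zero_iff.1 hb]⟩
    | succ n ih =>
      intro b hb
      obtain ⟨p, hp, hpx⟩ := exists_adj_dist_eq hc (x := b) (y := x') (n := n)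
        (by rw [T.dist_comm]; omega)
      rw [T.dist_comm] at hpx
      obtain ⟨a, rfl⟩ := ih p hpx
      obtain ⟨z, hz, hzb⟩ := (hE a (f a) (f_dist' a)).surjOn
        (mem_children.2 ⟨hp.symm, by omega⟩ : b ∈ _)
      rw [Finset.mem_coe, mem_children] at hz
      refine ⟨z, ?_⟩
      rw [f_step z (by omega), ← par_unique a z hz.1 hz.2, hzb]
  have f_bij : Function.Bijective f :=
    ⟨fun a b h => f_inj _ a b rfl h, fun b => f_surj _ b rfl⟩
  have f_adj' : ∀ a b, T.Adj (f a) (f b) → T.dist x' (f b) = T.dist x' (f a) + 1 →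
      T.Adj a b := by
    intro a b h1 h2
    have h0 : T.dist x b ≠ 0 := by have := f_dist' b; omega
    have h3 := mem_children.1 (f_mem b h0)
    have h4 : f a = f (par b) := eq_of_adj_of_dist_lt hT h1.symm h3.1.symm h2.symm h3.2.symm
    rw [f_bij.1 h4]
    exact (hpar b h0).1.symm
  have f_geo : ∀ n z, T.dist x z = n → T.dist x z + T.dist z y = T.dist x y →
      T.dist x' (f z) + T.dist (f z) y' = T.dist x' y' := by
    intro n
    induction n with
    | zero =>
      intro z hz _
      obtain rfl := hc.dist_eq_zero_iff.1 hz
      rw [f_x]; simp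
    | succ n ih =>
      intro z hz hzy
      have h0 : T.dist x z ≠ 0 := by omega
      have hp := hpar z h0
      have t1 := hc.dist_triangle (u := x) (v := par z) (w := y)
      have t2 := hc.dist_triangle (u := par z) (v := z) (w := y)
      have t3 := SimpleGraph.dist_eq_one_iff_adj.2 hp.1.symm
      rw [f_step z h0]
      exact hE' (par z) (f (par z)) (f_dist' _) (ih _ (by omega) (by omega)) z (mem_par z h0) hzy
  refine ⟨⟨Equiv.ofBijective f f_bij, ?_⟩, f_x, ?_⟩
  · intro a b
    simp only [Equiv.ofBijective_apply]
    constructor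
    · intro h
      rcases hT.dist_eq_dist_add_one_of_adj x' h with e | e
      · exact (f_adj' b a h.symm e).symm
      · exact f_adj' a b h e
    · intro h
      rcases hT.dist_eq_dist_add_one_of_adj x h with e | e
      · exact (f_adj b a h.symm e).symm
      · exact f_adj a b h e
  -- `f y` lies on a geodesic from `x'` to `y'` and has the full depth, so it is `y'`.
  · have h1 := f_geo _ y rfl (by simp)
    have h2 := f_dist' y
    exact hc.dist_eq_zero_iff.1 (show T.dist (f y) y' = 0 by omega)

theorem sum_sphere_map (hc : T.Connected) (γ : T ≃g T) (x : V) (k : ℕ) (f : V → ℝ) :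
    ∑ y ∈ sphere T (γ x) k, f y = ∑ y ∈ sphere T x k, f (γ y) := by
  symm
  refine Finset.sum_equiv γ.toEquiv (fun y => ?_) fun y _ => rfl
  rw [mem_sphere hc, mem_sphere hc]
  exact (dist_map hc γ x y).symm ▸ Iff.rfl

end Automorphism

/-! ### Entropy of finite partitions. -/

section Entropy

theorem preimage_prodMk_singleton {Ω δ ε : Type*} (U : Ω → δ) (W : Ω → ε) (c : δ × ε) :
    (fun ω => (U ω, W ω)) ⁻¹' {c} = U ⁻¹' {c.1} ∩ W ⁻¹' {c.2} := by
  ext ω; simp [Prod.ext_iff]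

/-- The entropy of the partition of `Ω` into the fibers of `X`. -/
noncomputable def fiberEntropy {Ω S : Type*} [MeasurableSpace Ω] (μ : Measure Ω) (X : Ω → S) : ℝ :=
  ∑ᶠ s, Real.negMulLog (μ.real (X ⁻¹' {s}))

variable {Ω : Type*} [MeasurableSpace Ω] {μ : Measure Ω}

theorem fiberEntropy_eq_finsum_mem {S : Type*} (X : Ω → S) : fiberEntropy μ X =
    ∑ᶠ A ∈ Set.range fun ω => {ω' | X ω' = X ω}, Real.negMulLog (μ.real A) := by
  have hrange : (Set.range fun ω => {ω' | X ω' = X ω}) = (fun s => X ⁻¹' {s}) '' Set.range X := by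
    rw [← Set.range_comp]; rfl
  rw [hrange, finsum_mem_image, fiberEntropy]
  · rw [finsum_mem_def]
    refine finsum_congr fun s => ?_
    by_cases h : s ∈ Set.range X
    · rw [Set.indicator_of_mem h]
    · rw [Set.indicator_of_notMem h, Set.preimage_singleton_eq_empty.2 h]; simp
  · rintro _ ⟨ω, rfl⟩ _ ⟨ω', rfl⟩ h
    exact (Set.ext_iff.1 h ω).1 rfl

/-- Only the partition into fibers matters, not the names of the values. Tuples can thus be
reordered and redundant components dropped. -/
theorem fiberEntropy_congr {S S' : Type*} {X : Ω → S} {X' : Ω → S'}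
    (h : ∀ ω ω', X ω = X ω' ↔ X' ω = X' ω') : fiberEntropy μ X = fiberEntropy μ X' := by
  simp only [fiberEntropy_eq_finsum_mem, h]

theorem fiberEntropy_eq_sum {S : Type*} [Fintype S] (X : Ω → S) :
    fiberEntropy μ X = ∑ s, Real.negMulLog (μ.real (X ⁻¹' {s})) := finsum_eq_sum_of_fintype _

theorem entropy_eq_fiberEntropy {S : Type*} [Fintype S] [MeasurableSpace S]
    [MeasurableSingletonClass S] {X : Ω → S} (hX : Measurable X) :
    entropy μ X = fiberEntropy μ X := by
  rw [entropy, fiberEntropy_eq_sum]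
  exact Finset.sum_congr rfl fun s _ => by
    rw [map_measureReal_apply hX (measurableSet_singleton s)]

/-- Submodularity of the entropy, for a table of nonnegative numbers. -/
theorem sum_negMulLog_submodular {α β γ : Type*} [Fintype α] [Fintype β] [Fintype γ]
    (p : α → β → γ → ℝ) (hp : ∀ a b c, 0 ≤ p a b c) :
    ∑ a, ∑ b, ∑ c, Real.negMulLog (p a b c) + ∑ c, Real.negMulLog (∑ a, ∑ b, p a b c) ≤
      ∑ a, ∑ c, Real.negMulLog (∑ b, p a b c) + ∑ b, ∑ c, Real.negMulLog (∑ a, p a b c) := by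
  set r : γ → ℝ := fun c => ∑ a, ∑ b, p a b c with hr
  set s : α → γ → ℝ := fun a c => ∑ b, p a b c with hs
  set t : β → γ → ℝ := fun b c => ∑ a, p a b c with ht
  have hs0 : ∀ a c, 0 ≤ s a c := fun a c => Finset.sum_nonneg fun b _ => hp a b c
  have ht0 : ∀ b c, 0 ≤ t b c := fun b c => Finset.sum_nonneg fun a _ => hp a b c
  have hr0 : ∀ c, 0 ≤ r c := fun c => Finset.sum_nonneg fun a _ => hs0 a c
  have hps : ∀ a b c, p a b c ≤ s a c := fun a b c =>
    Finset.single_le_sum (f := fun b => p a b c) (fun b _ => hp a b c) (Finset.mem_univ b)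
  have hpt : ∀ a b c, p a b c ≤ t b c := fun a b c =>
    Finset.single_le_sum (f := fun a => p a b c) (fun a _ => hp a b c) (Finset.mem_univ a)
  have hsr : ∀ a c, s a c ≤ r c := fun a c =>
    Finset.single_le_sum (f := fun a => s a c) (fun a _ => hs0 a c) (Finset.mem_univ a)
  -- `log x ≤ x - 1` at `x = s t / (r p)`, the ratio of the conditionally independent table to the
  -- given one, multiplied by `p`.
  have term : ∀ a b c, Real.negMulLog (p a b c) - p a b c * Real.log (r c) +
      p a b c * Real.log (s a c) + p a b c * Real.log (t b c) ≤
      s a c * t b c / r c - p a b c := by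
    intro a b c
    rcases (hp a b c).eq_or_lt with h | h
    · rw [← h]
      simp only [Real.negMulLog_zero, zero_mul, sub_zero, add_zero]
      exact div_nonneg (mul_nonneg (hs0 a c) (ht0 b c)) (hr0 c)
    · have h1 := h.trans_le (hps a b c)
      have h2 := h.trans_le (hpt a b c)
      have h3 := h1.trans_le (hsr a c)
      have hx : 0 < s a c * t b c / (r c * p a b c) := by positivity
      have := Real.log_le_sub_one_of_pos hx
      rw [Real.log_div (by positivity) (by positivity), Real.log_mul h1.ne' h2.ne',
        Real.log_mul h3.ne' h.ne'] at this
      have h4 := mul_le_mul_of_nonneg_left this h.le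
      have h5 : p a b c * (s a c * t b c / (r c * p a b c) - 1) =
        s a c * t b c / r c - p a b c := by field_simp
      rw [h5] at h4
      rw [Real.negMulLog]
      linarith
  have hsum := Finset.sum_le_sum fun a (_ : a ∈ Finset.univ) => Finset.sum_le_sum
    fun b (_ : b ∈ Finset.univ) => Finset.sum_le_sum fun c (_ : c ∈ Finset.univ) => term a b c
  simp only [Finset.sum_add_distrib, Finset.sum_sub_distrib] at hsum
  have e1 : ∑ a, ∑ b, ∑ c, p a b c * Real.log (r c) = -∑ c, Real.negMulLog (r c) := by
    rw [Finset.sum_congr rfl fun a _ => Finset.sum_comm, Finset.sum_comm, ← Finset.sum_neg_distrib]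
    refine Finset.sum_congr rfl fun c _ => ?_
    simp only [← Finset.sum_mul]
    rw [Real.negMulLog]; ring
  have e2 : ∑ a, ∑ b, ∑ c, p a b c * Real.log (s a c) = -∑ a, ∑ c, Real.negMulLog (s a c) := by
    rw [← Finset.sum_neg_distrib]
    refine Finset.sum_congr rfl fun a _ => ?_
    rw [Finset.sum_comm, ← Finset.sum_neg_distrib]
    refine Finset.sum_congr rfl fun c _ => ?_
    rw [← Finset.sum_mul, Real.negMulLog]; ring
  have e3 : ∑ a, ∑ b, ∑ c, p a b c * Real.log (t b c) = -∑ b, ∑ c, Real.negMulLog (t b c) := by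
    rw [Finset.sum_comm, ← Finset.sum_neg_distrib]
    refine Finset.sum_congr rfl fun b _ => ?_
    rw [Finset.sum_comm, ← Finset.sum_neg_distrib]
    refine Finset.sum_congr rfl fun c _ => ?_
    rw [← Finset.sum_mul, Real.negMulLog]; ring
  -- Both tables have the same total mass, so the right-hand sides of `term` sum to zero.
  have e4 : ∑ a, ∑ b, ∑ c, s a c * t b c / r c = ∑ a, ∑ b, ∑ c, p a b c := by
    rw [Finset.sum_congr rfl fun a _ => Finset.sum_comm, Finset.sum_comm,
      Finset.sum_congr rfl fun a _ => Finset.sum_comm (f := fun b c => p a b c),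
      Finset.sum_comm (f := fun a c => ∑ b, p a b c)]
    refine Finset.sum_congr rfl fun c _ => ?_
    have h1 : ∑ b, t b c = r c := Finset.sum_comm
    have h2 : ∑ a, s a c = r c := rfl
    have h3 : ∀ a, ∑ b, s a c * t b c / r c = s a c * r c / r c := by
      intro a; rw [← Finset.sum_div, ← Finset.mul_sum, h1]
    rw [Finset.sum_congr rfl fun a _ => h3 a, ← Finset.sum_div, ← Finset.sum_mul, h2]
    change _ = r c
    rcases eq_or_ne (r c) 0 with h | h
    · simp [h]
    · field_simp
  rw [e1, e2, e3, e4] at hsum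
  linarith

theorem sum_measureReal_fiber [IsFiniteMeasure μ] {S : Type*} [Fintype S] {X : Ω → S}
    (hX : ∀ s, MeasurableSet (X ⁻¹' {s})) (E : Set Ω) :
    ∑ s, μ.real (X ⁻¹' {s} ∩ E) = μ.real E := by
  classical
  have h := sum_measureReal_preimage_singleton (μ := μ.restrict E) (f := X) Finset.univ
    (fun s _ => hX s)
  simpa [measureReal_restrict_apply, hX] using h

variable {α β γ : Type*}

theorem measurableSet_fiber_prod {X : Ω → α} {Y : Ω → β} (hX : ∀ a, MeasurableSet (X ⁻¹' {a}))
    (hY : ∀ b, MeasurableSet (Y ⁻¹' {b})) (c : α × β) :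
    MeasurableSet ((fun ω => (X ω, Y ω)) ⁻¹' {c}) := by
  rw [preimage_prodMk_singleton]
  exact (hX _).inter (hY _)

/-- Submodularity of the entropy. -/
theorem fiberEntropy_submodular [IsFiniteMeasure μ] [Finite α] [Finite β] [Finite γ]
    {X : Ω → α} {Y : Ω → β} {Z : Ω → γ} (hX : ∀ a, MeasurableSet (X ⁻¹' {a}))
    (hY : ∀ b, MeasurableSet (Y ⁻¹' {b})) :
    fiberEntropy μ (fun ω => (X ω, Y ω, Z ω)) + fiberEntropy μ Z ≤
      fiberEntropy μ (fun ω => (X ω, Z ω)) + fiberEntropy μ (fun ω => (Y ω, Z ω)) := by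
  have := Fintype.ofFinite α
  have := Fintype.ofFinite β
  have := Fintype.ofFinite γ
  have h := sum_negMulLog_submodular
    (fun a b c => μ.real (X ⁻¹' {a} ∩ (Y ⁻¹' {b} ∩ Z ⁻¹' {c}))) fun _ _ _ => measureReal_nonneg
  have e1 : ∀ a c, ∑ b, μ.real (X ⁻¹' {a} ∩ (Y ⁻¹' {b} ∩ Z ⁻¹' {c})) =
      μ.real (X ⁻¹' {a} ∩ Z ⁻¹' {c}) := by
    intro a c
    rw [← sum_measureReal_fiber hY]
    exact Finset.sum_congr rfl fun b _ => by rw [Set.inter_left_comm]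
  have e2 : ∀ b c, ∑ a, μ.real (X ⁻¹' {a} ∩ (Y ⁻¹' {b} ∩ Z ⁻¹' {c})) =
      μ.real (Y ⁻¹' {b} ∩ Z ⁻¹' {c}) := fun b c => sum_measureReal_fiber hX _
  simp only [e1, e2, sum_measureReal_fiber hX] at h
  simp only [fiberEntropy_eq_sum, Fintype.sum_prod_type]
  simpa only [preimage_prodMk_singleton] using h

/-- Additivity of the entropy for independent random variables. -/
theorem fiberEntropy_prod_of_indep [IsProbabilityMeasure μ] [Finite α] [Finite β]
    {X : Ω → α} {Y : Ω → β} (hX : ∀ a, MeasurableSet (X ⁻¹' {a}))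
    (hY : ∀ b, MeasurableSet (Y ⁻¹' {b}))
    (h : ∀ a b, μ.real (X ⁻¹' {a} ∩ Y ⁻¹' {b}) = μ.real (X ⁻¹' {a}) * μ.real (Y ⁻¹' {b})) :
    fiberEntropy μ (fun ω => (X ω, Y ω)) = fiberEntropy μ X + fiberEntropy μ Y := by
  have := Fintype.ofFinite α
  have := Fintype.ofFinite β
  have s1 : ∑ a, μ.real (X ⁻¹' {a}) = 1 := by
    simpa using sum_measureReal_fiber (μ := μ) hX Set.univ
  have s2 : ∑ b, μ.real (Y ⁻¹' {b}) = 1 := by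
    simpa using sum_measureReal_fiber (μ := μ) hY Set.univ
  simp only [fiberEntropy_eq_sum, Fintype.sum_prod_type, preimage_prodMk_singleton, h,
    Real.negMulLog_mul, Finset.sum_add_distrib]
  simp only [← Finset.sum_mul, ← Finset.mul_sum, s1, s2, one_mul]

/-- The entropy is invariant under measure preserving maps. -/
theorem fiberEntropy_comp {Ω' S : Type*} [MeasurableSpace Ω'] {ν : Measure Ω'} {φ : Ω → Ω'}
    (hφ : MeasurePreserving φ μ ν) {X : Ω' → S} (hX : ∀ s, MeasurableSet (X ⁻¹' {s})) :
    fiberEntropy μ (X ∘ φ) = fiberEntropy ν X := by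
  refine finsum_congr fun s => ?_
  rw [Set.preimage_comp, hφ.measureReal_preimage (hX s).nullMeasurableSet]

end Entropy

/-! ### Random subsets and Russo's formula. -/

section RandomSubset

variable {V : Type*}

/-- The expectation of `g S` for a random subset `S` of `W` that contains each element of `W`
independently with probability `t`. -/
noncomputable def subsetMean (t : ℝ) (W : Finset V) (g : Finset V → ℝ) : ℝ :=
  ∑ S ∈ W.powerset, t ^ S.card * (1 - t) ^ (W.card - S.card) * g S

theorem subsetMean_insert [DecidableEq V] (t : ℝ) {W : Finset V} {a : V} (ha : a ∉ W)
    (g : Finset V → ℝ) :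
    subsetMean t (insert a W) g =
      (1 - t) * subsetMean t W g + t * subsetMean t W fun S => g (insert a S) := by
  rw [subsetMean, Finset.sum_powerset_insert ha, subsetMean, subsetMean, Finset.mul_sum,
    Finset.mul_sum]
  congr 1
  · refine Finset.sum_congr rfl fun S hS => ?_
    have := Finset.card_le_card (Finset.mem_powerset.1 hS)
    rw [Finset.card_insert_of_notMem ha, Nat.succ_sub this, pow_succ]
    ring
  · refine Finset.sum_congr rfl fun S hS => ?_
    rw [Finset.card_insert_of_notMem ha, Finset.card_insert_of_notMem
      fun h => ha (Finset.mem_powerset.1 hS h), Nat.add_sub_add_right]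
    ring

theorem subsetMean_mono {t : ℝ} (h0 : 0 ≤ t) (h1 : t ≤ 1) (W : Finset V) {g g' : Finset V → ℝ}
    (h : ∀ S ⊆ W, g S ≤ g' S) : subsetMean t W g ≤ subsetMean t W g' := by
  refine Finset.sum_le_sum fun S hS => mul_le_mul_of_nonneg_left (h S (Finset.mem_powerset.1 hS)) ?_
  have : 0 ≤ 1 - t := by linarith
  positivity

theorem subsetMean_congr {t : ℝ} (W : Finset V) {g g' : Finset V → ℝ}
    (h : ∀ S ⊆ W, g S = g' S) : subsetMean t W g = subsetMean t W g' :=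
  Finset.sum_congr rfl fun S hS => by rw [h S (Finset.mem_powerset.1 hS)]

theorem subsetMean_zero (t : ℝ) (W : Finset V) : subsetMean t W (fun _ => 0) = 0 := by
  simp [subsetMean]

theorem subsetMean_sub (t : ℝ) (W : Finset V) (g g' : Finset V → ℝ) :
    subsetMean t W (fun S => g S - g' S) = subsetMean t W g - subsetMean t W g' := by
  simp only [subsetMean, mul_sub, Finset.sum_sub_distrib]

theorem sum_subsetMean {ι : Type*} (t : ℝ) (W : Finset V) (I : Finset ι)
    (g : ι → Finset V → ℝ) :
    ∑ i ∈ I, subsetMean t W (g i) = subsetMean t W fun S => ∑ i ∈ I, g i S := by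
  simp only [subsetMean, Finset.mul_sum]
  exact Finset.sum_comm

theorem subsetMean_at_zero (W : Finset V) (g : Finset V → ℝ) : subsetMean 0 W g = g ∅ := by
  rw [subsetMean, Finset.sum_eq_single ∅]
  · simp
  · intro S _ hS
    rw [zero_pow (by simpa using hS)]; simp
  · simp

theorem subsetMean_at_one (W : Finset V) (g : Finset V → ℝ) : subsetMean 1 W g = g W := by
  rw [subsetMean, Finset.sum_eq_single W]
  · simp
  · intro S hS hne
    have : S.card < W.card := Finset.card_lt_card
      ((Finset.mem_powerset.1 hS).ssubset_of_ne hne)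
    rw [sub_self, zero_pow (by omega)]; simp
  · simp

/-- Elements that do not influence `g` may be removed from the ground set. -/
theorem subsetMean_of_subset [DecidableEq V] (t : ℝ) {B W : Finset V} (hBW : B ⊆ W) {g : Finset V → ℝ}
    (hg : ∀ S, ∀ a ∈ W, a ∉ B → g (insert a S) = g S) : subsetMean t W g = subsetMean t B g := by
  have key : ∀ C ⊆ W, Disjoint C B → subsetMean t (C ∪ B) g = subsetMean t B g := by
    intro C
    induction C using Finset.induction_on with
    | empty => simp
    | insert a C ha ih =>
      intro hC h
      rw [Finset.insert_subset_iff] at hC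
      rw [Finset.disjoint_insert_left] at h
      rw [Finset.insert_union, subsetMean_insert t (by simp [ha, h.1]),
        subsetMean_congr (g' := g) _ fun S _ => hg S a hC.1 h.1, ih hC.2 h.2]
      ring
  rw [← key (W \ B) Finset.sdiff_subset Finset.sdiff_disjoint, Finset.sdiff_union_of_subset hBW]

/-- Russo's formula. -/
theorem hasDerivAt_subsetMean [DecidableEq V] (t : ℝ) (W : Finset V) (g : Finset V → ℝ) :
    HasDerivAt (fun t => subsetMean t W g)
      (∑ w ∈ W, subsetMean t (W.erase w) fun S => g (insert w S) - g S) t := by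
  induction W using Finset.induction_on generalizing g with
  | empty =>
    simp only [subsetMean, Finset.powerset_empty, Finset.sum_singleton, Finset.card_empty,
      Finset.sum_empty, Nat.sub_zero, pow_zero]
    exact hasDerivAt_const t _
  | insert a W ha ih =>
    -- Product rule in the recursion `subsetMean_insert`: the derivatives of the two weights produce
    -- the summand of `a` itself.
    have h1 := ((hasDerivAt_id t).const_sub 1).mul (ih g)
    have h2 := (hasDerivAt_id t).mul (ih fun S => g (insert a S))
    have h3 := h1.add h2
    have e : (fun t => subsetMean t (insert a W) g) = fun t => (1 - t) * subsetMean t W g +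
        t * subsetMean t W fun S => g (insert a S) := by
      funext t; exact subsetMean_insert t ha g
    rw [e]
    refine h3.congr_deriv ?_
    rw [Finset.sum_insert ha, Finset.erase_insert ha, subsetMean_sub]
    have e2 : ∀ w ∈ W, (subsetMean t ((insert a W).erase w) fun S => g (insert w S) - g S) =
        (1 - t) * (subsetMean t (W.erase w) fun S => g (insert w S) - g S) +
        t * subsetMean t (W.erase w) fun S => g (insert a (insert w S)) - g (insert a S) := by
      intro w hw
      have hne : w ≠ a := fun h => ha (h ▸ hw)
      rw [Finset.erase_insert_of_ne hne.symm, subsetMean_insert t (by simp [ha])]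
      simp only [Finset.insert_comm w a]
    rw [Finset.sum_congr rfl e2, Finset.sum_add_distrib, ← Finset.mul_sum, ← Finset.mul_sum]
    simp only [id]
    ring

theorem subsetMean_map {V' : Type*} (t : ℝ) (e : V ↪ V') (W : Finset V)
    (g : Finset V' → ℝ) :
    subsetMean t (W.map e) g = subsetMean t W fun S => g (S.map e) := by
  rw [subsetMean, subsetMean]
  symm
  refine Finset.sum_nbij (fun S => S.map e) ?_ ?_ ?_ ?_
  · intro S hS
    rw [Finset.mem_powerset] at hS ⊢
    exact Finset.map_subset_map.2 hS
  · intro S _ S' _ h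
    exact Finset.map_injective e h
  · intro S hS
    rw [Finset.mem_coe, Finset.mem_powerset] at hS
    obtain ⟨S', hS', rfl⟩ := Finset.subset_map_iff.1 hS
    exact ⟨S', by simpa using hS', rfl⟩
  · intro S _
    simp only [Finset.card_map]

end RandomSubset

/-! ### Conditional entropy given finitely many quantized labels. -/

section Observation

variable {V A : Type*}

instance : IsProbabilityMeasure (iidUniform V) := by
  unfold iidUniform; infer_instance

theorem measurePreserving_autAct {T : SimpleGraph V} (γ : T ≃g T) :
    MeasurePreserving (autAct γ) (iidUniform V) (iidUniform V) := by
  have h := Measure.infinitePi_map_piCongrLeft (X := fun _ : V => unitInterval)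
    (fun _ => (volume : Measure unitInterval)) γ.toEquiv
  refine ⟨measurable_pi_lambda _ fun v => measurable_pi_apply _, ?_⟩
  have e : (autAct γ : (V → unitInterval) → V → unitInterval) =
      MeasurableEquiv.piCongrLeft (fun _ => unitInterval) γ.toEquiv := by
    funext f v
    obtain ⟨w, rfl⟩ := γ.surjective v
    rw [MeasurableEquiv.coe_piCongrLeft]
    refine Eq.trans ?_ (Equiv.piCongrLeft_apply_apply (fun _ => unitInterval) γ.toEquiv f w).symm
    simp [autAct]
  rw [e]
  exact h

/-- The quantized labels of the vertices in `S`. -/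
def obs (Q : unitInterval → A) (S : Finset V) (z : V → unitInterval) : S → A := fun w => Q (z w)

theorem obs_eq_iff {Q : unitInterval → A} {S : Finset V} {z z' : V → unitInterval} :
    obs Q S z = obs Q S z' ↔ ∀ w ∈ S, Q (z w) = Q (z' w) := by
  simp [obs, funext_iff]

/-- `X` is a function of the quantized labels of the vertices in `B`. -/
def DeterminedBy {α : Type*} (Q : unitInterval → A) (B : Finset V)
    (X : (V → unitInterval) → α) : Prop :=
  ∀ z z', (∀ w ∈ B, Q (z w) = Q (z' w)) → X z = X z'

theorem DeterminedBy.mono {α : Type*} {Q : unitInterval → A} {B B' : Finset V} (h : B ⊆ B')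
    {X : (V → unitInterval) → α} (hX : DeterminedBy Q B X) : DeterminedBy Q B' X :=
  fun z z' hz => hX z z' fun w hw => hz w (h hw)

variable {Q : unitInterval → A} {α β : Type*}

theorem determinedBy_obs (Q : unitInterval → A) (S : Finset V) : DeterminedBy Q S (obs Q S) :=
  fun _ _ h => obs_eq_iff.2 h

theorem obs_insert_eq_iff [DecidableEq V] {S : Finset V} {w : V} {z z' : V → unitInterval} :
    obs Q (insert w S) z = obs Q (insert w S) z' ↔
      Q (z w) = Q (z' w) ∧ obs Q S z = obs Q S z' := by
  simp [obs_eq_iff]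

/-- The conditional entropy of `X` given the quantized labels of the vertices in `S`. -/
noncomputable def condEntropy (Q : unitInterval → A) (X : (V → unitInterval) → α)
    (S : Finset V) : ℝ :=
  fiberEntropy (iidUniform V) (fun z => (X z, obs Q S z)) - fiberEntropy (iidUniform V) (obs Q S)

theorem condEntropy_empty (X : (V → unitInterval) → α) :
    condEntropy Q X ∅ = fiberEntropy (iidUniform V) X := by
  have h1 : fiberEntropy (iidUniform V) (fun z => (X z, obs Q ∅ z)) =
      fiberEntropy (iidUniform V) X :=
    fiberEntropy_congr fun z z' => by simp [obs_eq_iff]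
  have h2 : fiberEntropy (iidUniform V) (obs Q (∅ : Finset V)) =
      fiberEntropy (iidUniform V) (fun _ : V → unitInterval => ()) :=
    fiberEntropy_congr fun z z' => by simp [obs_eq_iff]
  rw [condEntropy, h1, h2, fiberEntropy_eq_sum (fun _ => ())]
  simp

theorem condEntropy_eq_zero {B S : Finset V} (h : B ⊆ S) {X : (V → unitInterval) → α}
    (hX : DeterminedBy Q B X) : condEntropy Q X S = 0 := by
  rw [condEntropy, sub_eq_zero]
  refine fiberEntropy_congr fun z z' => ?_
  rw [Prod.mk.injEq]
  exact ⟨fun h => h.2, fun hz => ⟨hX.mono h z z' (obs_eq_iff.1 hz), hz⟩⟩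

theorem obs_map_autAct {T : SimpleGraph V} (γ : T ≃g T) (S : Finset V)
    {z z' : V → unitInterval} :
    obs Q (S.map γ.toEquiv.toEmbedding) (autAct γ z) =
      obs Q (S.map γ.toEquiv.toEmbedding) (autAct γ z') ↔ obs Q S z = obs Q S z' := by
  simp only [obs_eq_iff, autAct, Finset.mem_map, forall_exists_index, and_imp,
    forall_apply_eq_imp_iff₂]
  simp

variable [MeasurableSpace A]

theorem measurable_obs (hQ : Measurable Q) (S : Finset V) : Measurable (obs Q S) :=
  measurable_pi_lambda _ fun _ => hQ.comp (measurable_pi_apply _)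

theorem indepFun_obs (hQ : Measurable Q) {S S' : Finset V} (h : Disjoint S S') :
    IndepFun (obs Q S) (obs Q S') (iidUniform V) :=
  (iIndepFun_infinitePi (P := fun _ : V => (volume : Measure unitInterval))
    (X := fun _ => Q) fun _ => hQ).indepFun_finset S S' h
    fun w => hQ.comp (measurable_pi_apply w)

variable [Finite A] [DiscreteMeasurableSpace A]

theorem DeterminedBy.exists_preimage_eq {B : Finset V}
    {X : (V → unitInterval) → α} (hX : DeterminedBy Q B X) (a : α) :
    ∃ C : Set (B → A), MeasurableSet C ∧ X ⁻¹' {a} = obs Q B ⁻¹' C := by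
  refine ⟨{c | ∃ z, obs Q B z = c ∧ X z = a}, MeasurableSet.of_discrete, ?_⟩
  ext z
  constructor
  · exact fun h => ⟨z, rfl, h⟩
  · rintro ⟨z', h1, h2⟩
    rw [obs_eq_iff] at h1
    rw [Set.mem_preimage, Set.mem_singleton_iff, ← h2]
    exact (hX z' z h1).symm

theorem DeterminedBy.measurableSet_fiber (hQ : Measurable Q) {B : Finset V}
    {X : (V → unitInterval) → α} (hX : DeterminedBy Q B X) (a : α) :
    MeasurableSet (X ⁻¹' {a}) := by
  obtain ⟨C, hC, h⟩ := hX.exists_preimage_eq a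
  rw [h]
  exact measurable_obs hQ B hC

theorem condEntropy_map (hQ : Measurable Q) {T : SimpleGraph V} (γ : T ≃g T)
    {X : (V → unitInterval) → α} (hX : ∀ a, MeasurableSet (X ⁻¹' {a})) (S : Finset V) :
    condEntropy Q X (S.map γ.toEquiv.toEmbedding) = condEntropy Q (X ∘ autAct γ) S := by
  have hm := (determinedBy_obs Q (S.map γ.toEquiv.toEmbedding)).measurableSet_fiber hQ
  rw [condEntropy, condEntropy, ← fiberEntropy_comp (measurePreserving_autAct γ) hm,
    ← fiberEntropy_comp (measurePreserving_autAct γ) (measurableSet_fiber_prod hX hm)]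
  congr 1
  · refine fiberEntropy_congr fun z z' => ?_
    simp only [Function.comp_apply, Prod.mk.injEq, obs_map_autAct]
  · refine fiberEntropy_congr fun z z' => ?_
    simp only [Function.comp_apply, obs_map_autAct]

theorem fiberEntropy_prod_obs_singleton (hQ : Measurable Q) [Finite α] {B : Finset V}
    {X : (V → unitInterval) → α} (hX : DeterminedBy Q B X) {w : V} (hw : w ∉ B) :
    fiberEntropy (iidUniform V) (fun z => (X z, obs Q {w} z)) =
      fiberEntropy (iidUniform V) X + fiberEntropy (iidUniform V) (obs Q {w}) := by
  refine fiberEntropy_prod_of_indep (hX.measurableSet_fiber hQ)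
    ((determinedBy_obs Q _).measurableSet_fiber hQ) fun a b => ?_
  obtain ⟨D, hD, h⟩ := hX.exists_preimage_eq a
  rw [h, measureReal_def,
    (indepFun_obs hQ (Finset.disjoint_singleton_right.2 hw)).measure_inter_preimage_eq_mul
      _ _ hD MeasurableSet.of_discrete, ENNReal.toReal_mul]
  rfl

variable [DecidableEq V]

/-- A new label outside `B` is independent of `X` and the labels in `S` jointly, so it adds the same
amount to both entropies. This locality keeps the sums over vertices finite. -/
theorem condEntropy_insert_of_notMem (hQ : Measurable Q) [Finite α] {B : Finset V}
    {X : (V → unitInterval) → α} (hX : DeterminedBy Q B X) (S : Finset V) {w : V} (hw : w ∉ B) :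
    condEntropy Q X (insert w S) = condEntropy Q X S := by
  by_cases hwS : w ∈ S
  · rw [Finset.insert_eq_of_mem hwS]
  have h1 : fiberEntropy (iidUniform V) (fun z => (X z, obs Q (insert w S) z)) =
      fiberEntropy (iidUniform V) (fun z => ((X z, obs Q S z), obs Q {w} z)) := by
    refine fiberEntropy_congr fun z z' => ?_
    simp only [Prod.mk.injEq, obs_insert_eq_iff, obs_eq_iff (S := {w}), Finset.mem_singleton,
      forall_eq]
    tauto
  have h2 : fiberEntropy (iidUniform V) (obs Q (insert w S)) =
      fiberEntropy (iidUniform V) (fun z => (obs Q S z, obs Q {w} z)) := by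
    refine fiberEntropy_congr fun z z' => ?_
    simp only [Prod.mk.injEq, obs_insert_eq_iff, obs_eq_iff (S := {w}), Finset.mem_singleton,
      forall_eq]
    tauto
  have d1 : DeterminedBy Q (B ∪ S) (fun z => (X z, obs Q S z)) := fun z z' hz =>
    Prod.ext (hX.mono Finset.subset_union_left z z' hz)
      ((determinedBy_obs Q S).mono Finset.subset_union_right z z' hz)
  rw [condEntropy, condEntropy, h1, h2, fiberEntropy_prod_obs_singleton hQ d1 (by simp [hw, hwS]),
    fiberEntropy_prod_obs_singleton hQ (determinedBy_obs Q S) hwS]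
  ring

/-- The information gained about a function of `X` by revealing one more label is at most the
information gained about `X`. -/
theorem condEntropy_sub_insert_le (hQ : Measurable Q) [Finite α] [Finite β]
    {X : (V → unitInterval) → α} {X' : (V → unitInterval) → β}
    (hX' : ∀ b, MeasurableSet (X' ⁻¹' {b}))
    (h : ∀ z z', X' z = X' z' → X z = X z') (S : Finset V) (w : V) :
    condEntropy Q X S - condEntropy Q X (insert w S) ≤
      condEntropy Q X' S - condEntropy Q X' (insert w S) := by
  have hw : ∀ a, MeasurableSet ((fun z : V → unitInterval => Q (z w)) ⁻¹' {a}) := fun a =>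
    (hQ.comp (measurable_pi_apply w)) MeasurableSet.of_discrete
  -- Submodularity for `X'` and the label of `w`, given `X` and the labels in `S`; the component `X`
  -- is redundant wherever `X'` is present.
  have key := fiberEntropy_submodular (μ := iidUniform V) (Z := fun z => (X z, obs Q S z)) hX' hw
  have e1 : fiberEntropy (iidUniform V) (fun z => (X' z, Q (z w), X z, obs Q S z)) =
      fiberEntropy (iidUniform V) (fun z => (X' z, obs Q (insert w S) z)) := by
    refine fiberEntropy_congr fun z z' => ?_
    simp only [Prod.mk.injEq, obs_insert_eq_iff]
    have := h z z'
    tauto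
  have e2 : fiberEntropy (iidUniform V) (fun z => (X' z, X z, obs Q S z)) =
      fiberEntropy (iidUniform V) (fun z => (X' z, obs Q S z)) := by
    refine fiberEntropy_congr fun z z' => ?_
    simp only [Prod.mk.injEq]
    have := h z z'
    tauto
  have e3 : fiberEntropy (iidUniform V) (fun z => (Q (z w), X z, obs Q S z)) =
      fiberEntropy (iidUniform V) (fun z => (X z, obs Q (insert w S) z)) := by
    refine fiberEntropy_congr fun z z' => ?_
    simp only [Prod.mk.injEq, obs_insert_eq_iff]
    tauto
  rw [e1, e2, e3] at key
  simp only [condEntropy]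
  linarith

theorem condEntropy_insert_le (hQ : Measurable Q) [Finite α] {X : (V → unitInterval) → α}
    (hX : ∀ a, MeasurableSet (X ⁻¹' {a})) (S : Finset V) (w : V) :
    condEntropy Q X (insert w S) ≤ condEntropy Q X S := by
  have h := condEntropy_sub_insert_le hQ (X := fun _ => ()) hX (fun _ _ _ => rfl) S w
  have h0 : ∀ S : Finset V, condEntropy Q (fun _ => ()) S = 0 := fun S =>
    condEntropy_eq_zero (Finset.empty_subset S) fun _ _ _ => rfl
  rw [h0, h0] at h
  linarith

end Observation

/-! ### The entropy inequality for block factors. -/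

section BlockFactor

variable {V A M : Type*} {T : SimpleGraph V}

theorem fiberEntropy_pair_map {F : (V → unitInterval) → V → M}
    (hF : ∀ (γ : T ≃g T) (z : V → unitInterval), F (autAct γ z) = autAct γ (F z))
    (γ : T ≃g T) {x y : V}
    (hm : ∀ a, MeasurableSet ((fun z => (F z (γ x), F z (γ y))) ⁻¹' {a})) :
    fiberEntropy (iidUniform V) (fun z => (F z (γ x), F z (γ y))) =
      fiberEntropy (iidUniform V) (fun z => (F z x, F z y)) := by
  rw [← fiberEntropy_comp (measurePreserving_autAct γ) hm]
  simp only [Function.comp_def, hF, autAct, RelIso.symm_apply_apply]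

variable [T.LocallyFinite]

/-- `Y` is an equivariant labeling such that the label of a vertex is determined by the quantized
labels in the ball of radius `R` around it. -/
structure IsBlockFactor (T : SimpleGraph V) (Q : unitInterval → A) (R : ℕ)
    (Y : (V → unitInterval) → V → M) : Prop where
  determined : ∀ v, DeterminedBy Q (cball T v R) fun z => Y z v
  equivariant : ∀ (γ : T ≃g T) (z : V → unitInterval), Y (autAct γ z) = autAct γ (Y z)

theorem cball_map (hc : T.Connected) (γ : T ≃g T) (x : V) (n : ℕ) :
    cball T (γ x) n = (cball T x n).map γ.toEquiv.toEmbedding := by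
  ext y
  obtain ⟨y, rfl⟩ := γ.surjective y
  rw [mem_cball hc, dist_map hc, ← mem_cball hc]
  exact (Finset.mem_map' γ.toEquiv.toEmbedding).symm

/-- The entropy of the pairs `(x, y)` with `y` at distance `k`, minus `κ` times the entropy at `x`,
all conditioned on the quantized labels in `S`. -/
noncomputable def pairSurplus (T : SimpleGraph V) (Q : unitInterval → A)
    (Y : (V → unitInterval) → V → M) (k : ℕ) (κ : ℝ) (x : V) (S : Finset V) : ℝ :=
  ∑ y ∈ sphere T x k, condEntropy Q (fun z => (Y z x, Y z y)) S -
    κ * condEntropy Q (fun z => Y z x) S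

theorem IsBlockFactor.pair_determined (hc : T.Connected) {Q : unitInterval → A} {R : ℕ}
    {Y : (V → unitInterval) → V → M} (hY : IsBlockFactor T Q R Y) {x y : V} {k : ℕ}
    (h : T.dist x y ≤ k) : DeterminedBy Q (cball T x (R + k)) fun z => (Y z x, Y z y) := by
  intro z z' hz
  refine Prod.ext (hY.determined x z z' fun w hw => hz w ?_)
    (hY.determined y z z' fun w hw => hz w ?_)
  · rw [mem_cball hc] at hw ⊢; omega
  · rw [mem_cball hc] at hw ⊢
    have := hc.dist_triangle (u := x) (v := y) (w := w)
    omega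

variable [Finite A] [MeasurableSpace A] [DiscreteMeasurableSpace A] {Q : unitInterval → A}
  {R : ℕ} {Y : (V → unitInterval) → V → M}

theorem pairSurplus_map (hc : T.Connected) (hQ : Measurable Q) (hY : IsBlockFactor T Q R Y)
    (k : ℕ) (κ : ℝ) (γ : T ≃g T) (x : V) (S : Finset V) :
    pairSurplus T Q Y k κ (γ x) (S.map γ.toEquiv.toEmbedding) = pairSurplus T Q Y k κ x S := by
  have e : ∀ z v, Y (autAct γ z) (γ v) = Y z v := by
    intro z v
    rw [hY.equivariant, autAct, RelIso.symm_apply_apply]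
  rw [pairSurplus, pairSurplus, sum_sphere_map hc]
  congr 1
  · refine Finset.sum_congr rfl fun y _ => ?_
    rw [condEntropy_map hQ γ ((hY.pair_determined hc le_rfl).measurableSet_fiber hQ)]
    simp only [Function.comp_def, e]
  · rw [condEntropy_map hQ γ ((hY.determined _).measurableSet_fiber hQ)]
    simp only [Function.comp_def, e]

variable [Finite M]

theorem pairSurplus_insert_of_notMem [DecidableEq V] (hc : T.Connected) (hQ : Measurable Q)
    (hY : IsBlockFactor T Q R Y) (k : ℕ) (κ : ℝ) (x : V) (S : Finset V) {a : V}
    (ha : a ∉ cball T x (R + k)) :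
    pairSurplus T Q Y k κ x (insert a S) = pairSurplus T Q Y k κ x S := by
  rw [pairSurplus, pairSurplus]
  congr 1
  · refine Finset.sum_congr rfl fun y hy => ?_
    rw [mem_sphere hc] at hy
    exact condEntropy_insert_of_notMem hQ (hY.pair_determined hc hy.le) S ha
  · rw [condEntropy_insert_of_notMem hQ (hY.determined x) S]
    intro h
    rw [mem_cball hc] at h ha
    omega

/-- The information gain `f` vanishes outside the ball of radius `R` around `o`, so `le_sum_max`
applies on that ball enlarged by `k + 1`, and each pair gains at least as much as either of its
members. -/
theorem sum_pairSurplus_insert_le [DecidableEq V] (hT : T.IsTree) {d : ℕ}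
    (hreg : T.IsRegularOfDegree d) (hQ : Measurable Q) (hY : IsBlockFactor T Q R Y) {k N : ℕ}
    (hN : ∀ o x, descentCount T o x (k + 1) ≤ N) (o : V) (S : Finset V) :
    0 ≤ ∑ w ∈ cball T o (R + (k + 1)),
      (pairSurplus T Q Y (k + 1) (2 * (d * (d - 1 : ℕ) ^ k) - N) w S -
        pairSurplus T Q Y (k + 1) (2 * (d * (d - 1 : ℕ) ^ k) - N) w (insert o S)) := by
  have hc := hT.1
  set κ : ℝ := 2 * (d * (d - 1 : ℕ) ^ k) - N with hκ
  set f : V → ℝ := fun w => condEntropy Q (fun z => Y z w) S -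
    condEntropy Q (fun z => Y z w) (insert o S) with hf
  have hf0 : ∀ x, 0 ≤ f x := fun x => sub_nonneg.2
    (condEntropy_insert_le hQ ((hY.determined x).measurableSet_fiber hQ) S o)
  have hfs : ∀ x y, f x ≠ 0 → T.dist x y ≤ k + 1 → y ∈ cball T o (R + (k + 1)) := by
    intro x y hx hxy
    by_cases ho : o ∈ cball T x R
    · rw [mem_cball hc] at ho ⊢
      have := hc.dist_triangle (u := o) (v := x) (w := y)
      rw [T.dist_comm (u := o) (v := x)] at this
      omega
    · exact absurd (sub_eq_zero.2 (condEntropy_insert_of_notMem hQ (hY.determined x) S ho).symm) hx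
  have key := le_sum_max hT hreg o k N (hN o) (cball T o (R + (k + 1))) f hf0 hfs
  have hpair : ∀ w y, max (f w) (f y) ≤ condEntropy Q (fun z => (Y z w, Y z y)) S -
      condEntropy Q (fun z => (Y z w, Y z y)) (insert o S) := by
    intro w y
    have hm := (hY.pair_determined hc (le_refl (T.dist w y))).measurableSet_fiber hQ
    refine max_le ?_ ?_
    · exact condEntropy_sub_insert_le hQ hm (fun z z' h => (Prod.mk.inj h).1) S o
    · exact condEntropy_sub_insert_le hQ hm (fun z z' h => (Prod.mk.inj h).2) S o
  have key2 := key.trans (Finset.sum_le_sum fun w _ => Finset.sum_le_sum fun y _ => hpair w y)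
  rw [Finset.mul_sum, ← sub_nonneg, ← Finset.sum_sub_distrib] at key2
  refine key2.trans_eq (Finset.sum_congr rfl fun w _ => ?_)
  rw [pairSurplus, pairSurplus, Finset.sum_sub_distrib]
  ring

/-- Interpolates between no labels and all labels of a ball that determines every pair involved,
where the surplus is zero; the mean surplus decreases along the way. -/
theorem pairSurplus_empty_nonneg (hT : T.IsTree) {d : ℕ}
    (hreg : T.IsRegularOfDegree d) (hQ : Measurable Q) (hY : IsBlockFactor T Q R Y) {k N : ℕ}
    (hN : ∀ o x, descentCount T o x (k + 1) ≤ N) (o : V) :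
    0 ≤ pairSurplus T Q Y (k + 1) (2 * (d * (d - 1 : ℕ) ^ k) - N) o ∅ := by
  classical
  have hc := hT.1
  set κ : ℝ := 2 * (d * (d - 1 : ℕ) ^ k) - N with hκ
  set g : V → Finset V → ℝ := pairSurplus T Q Y (k + 1) κ with hg
  set B : V → Finset V := fun x => cball T x (R + (k + 1)) with hB
  have hloc : ∀ x S a, a ∉ B x → g x (insert a S) = g x S := fun x S a ha =>
    pairSurplus_insert_of_notMem hc hQ hY (k + 1) κ x S ha
  have hmap : ∀ (γ : T ≃g T) x S, g (γ x) (S.map γ.toEquiv.toEmbedding) = g x S :=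
    pairSurplus_map hc hQ hY (k + 1) κ
  have hderiv : ∀ t ∈ Set.Icc (0 : ℝ) 1, ∑ w ∈ B o,
      subsetMean t ((B o).erase w) (fun S => g o (insert w S) - g o S) ≤ 0 := by
    intro t ht
    -- Mass transport by an automorphism exchanging `o` and `w`. The ground set, which depends on
    -- `w`, is enlarged to a ball containing every `B w`, so that the sum over `w` can be moved
    -- inside the mean.
    have hswap : ∀ w ∈ B o, subsetMean t ((B o).erase w) (fun S => g o (insert w S) - g o S) =
        subsetMean t ((cball T o (2 * (R + (k + 1)))).erase o)
          fun S => g w (insert o S) - g w S := by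
      intro w hw
      obtain ⟨γ, h1, h2⟩ := exists_aut_of_dist_eq hT hreg (T.dist_comm (u := w) (v := o))
      have hset : (B o).erase w = ((B w).erase o).map γ.toEquiv.toEmbedding := by
        rw [Finset.map_erase, hB]
        simp only
        rw [← cball_map hc, h1]
        exact congrArg _ h2.symm
      rw [hset, subsetMean_map]
      have e1 : ∀ S : Finset V, g o (insert w (S.map γ.toEquiv.toEmbedding)) =
          g w (insert o S) := by
        intro S
        rw [← hmap γ w (insert o S), Finset.map_insert, h1]
        exact congrArg (fun v => g o (insert v (S.map γ.toEquiv.toEmbedding))) h2.symm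
      have e2 : ∀ S : Finset V, g o (S.map γ.toEquiv.toEmbedding) = g w S := by
        intro S
        rw [← hmap γ w S, h1]
      simp only [e1, e2]
      symm
      apply subsetMean_of_subset
      · apply Finset.erase_subset_erase
        intro v hv
        rw [mem_cball hc] at hw hv ⊢
        have := hc.dist_triangle (u := o) (v := w) (w := v)
        omega
      · intro S a ha ha'
        have hao : a ≠ o := Finset.ne_of_mem_erase ha
        have haB : a ∉ B w := fun h => ha' (Finset.mem_erase.2 ⟨hao, h⟩)
        rw [Finset.insert_comm, hloc w _ a haB, hloc w _ a haB]
    rw [Finset.sum_congr rfl hswap, sum_subsetMean]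
    refine le_trans (subsetMean_mono ht.1 ht.2 _ (g' := fun _ => 0) fun S _ => ?_)
      (subsetMean_zero _ _).le
    have := sum_pairSurplus_insert_le hT hreg hQ hY hN o S
    rw [← neg_nonneg, ← Finset.sum_neg_distrib]
    simpa only [neg_sub] using this
  have hanti : AntitoneOn (fun t => subsetMean t (B o) (g o)) (Set.Icc 0 1) := by
    apply antitoneOn_of_hasDerivWithinAt_nonpos (convex_Icc 0 1)
      (f' := fun t => ∑ w ∈ B o,
        subsetMean t ((B o).erase w) (fun S => g o (insert w S) - g o S))
    · exact fun t _ => (hasDerivAt_subsetMean t (B o) (g o)).continuousAt.continuousWithinAt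
    · exact fun t _ => (hasDerivAt_subsetMean t (B o) (g o)).hasDerivWithinAt
    · exact fun t ht => hderiv t (interior_subset ht)
  have h01 := hanti (Set.left_mem_Icc.2 zero_le_one) (Set.right_mem_Icc.2 zero_le_one) zero_le_one
  simp only [subsetMean_at_zero, subsetMean_at_one] at h01
  refine le_trans (le_of_eq ?_) h01
  rw [hg, pairSurplus, Finset.sum_eq_zero, condEntropy_eq_zero _ (hY.determined o)]
  · simp
  · intro v hv
    rw [mem_cball hc] at hv ⊢
    omega
  · intro y hy
    rw [mem_sphere hc] at hy
    exact condEntropy_eq_zero (Finset.Subset.refl _) (hY.pair_determined hc hy.le)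

/-- The entropy inequality for block factors. -/
theorem IsBlockFactor.entropy_inequality (hT : T.IsTree) {d : ℕ}
    (hreg : T.IsRegularOfDegree d) (hQ : Measurable Q) (hY : IsBlockFactor T Q R Y) {k N : ℕ}
    (hN : ∀ o x, descentCount T o x (k + 1) ≤ N) {u v : V} (huv : T.dist u v = k + 1) :
    (2 * (d * (d - 1 : ℕ) ^ k) - N) * fiberEntropy (iidUniform V) (fun z => Y z u) ≤
      (d * (d - 1 : ℕ) ^ k) * fiberEntropy (iidUniform V) (fun z => (Y z u, Y z v)) := by
  have hc := hT.1
  have h := pairSurplus_empty_nonneg hT hreg hQ hY hN u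
  rw [pairSurplus, condEntropy_empty] at h
  have e : ∀ y ∈ sphere T u (k + 1), condEntropy Q (fun z => (Y z u, Y z y)) ∅ =
      fiberEntropy (iidUniform V) (fun z => (Y z u, Y z v)) := by
    intro y hy
    rw [mem_sphere hc] at hy
    obtain ⟨γ, h1, h2⟩ := exists_aut_of_dist_eq hT hreg (hy.trans huv.symm)
    rw [condEntropy_empty, ← fiberEntropy_pair_map hY.equivariant γ
      ((hY.pair_determined hc le_rfl).measurableSet_fiber hQ), h1, h2]
  rw [Finset.sum_congr rfl e, Finset.sum_const, nsmul_eq_mul, card_sphere_succ hT hreg] at h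
  push_cast at h ⊢
  linarith

end BlockFactor

/-! ### Approximation of factors of IID by block factors. -/

section Approximation

variable {V : Type*}

/-- The events that depend only on finitely many quantized labels. -/
def quantizedEvents (V : Type*) : Set (Set (V → unitInterval)) :=
  {E | ∃ (A : Type) (_ : Finite A) (Q : unitInterval → A) (S : Finset V),
    (∀ a, MeasurableSet (Q ⁻¹' {a})) ∧ DeterminedBy Q S (· ∈ E)}

theorem isSetAlgebra_quantizedEvents : IsSetAlgebra (quantizedEvents V) where
  empty_mem := ⟨Unit, inferInstance, fun _ => (), ∅, fun _ => by simp, fun _ _ _ => rfl⟩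
  compl_mem := by
    rintro E ⟨A, hA, Q, S, hQ, hE⟩
    exact ⟨A, hA, Q, S, hQ, fun z z' h => congrArg Not (hE z z' h)⟩
  union_mem := by
    classical
    rintro E E' ⟨A, hA, Q, S, hQ, hE⟩ ⟨A', hA', Q', S', hQ', hE'⟩
    -- The pair of two quantizations refines both.
    refine ⟨A × A', inferInstance, fun t => (Q t, Q' t), S ∪ S',
      measurableSet_fiber_prod hQ hQ', fun z z' h => ?_⟩
    exact congrArg₂ Or
      (hE z z' fun w hw => (Prod.mk.inj (h w (Finset.mem_union_left _ hw))).1)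
      (hE' z z' fun w hw => (Prod.mk.inj (h w (Finset.mem_union_right _ hw))).2)

theorem measurable_of_measurableSet_fiber {Ω A : Type*} [MeasurableSpace Ω] [Finite A]
    [MeasurableSpace A] {Q : Ω → A} (hQ : ∀ a, MeasurableSet (Q ⁻¹' {a})) :
    Measurable Q := measurable_to_countable' hQ

theorem generateFrom_quantizedEvents :
    (MeasurableSpace.pi : MeasurableSpace (V → unitInterval)) =
      MeasurableSpace.generateFrom (quantizedEvents V) := by
  apply le_antisymm
  · rw [MeasurableSpace.pi_eq_generateFrom_projections]
    refine MeasurableSpace.generateFrom_mono ?_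
    rintro _ ⟨v, C, hC, rfl⟩
    -- Quantize by membership in `C`, a label with two values.
    refine ⟨Prop, inferInstance, (· ∈ C), {v}, fun p => ?_, fun z z' h => ?_⟩
    · exact (measurable_mem.2 hC) (MeasurableSet.of_discrete)
    · exact h v (Finset.mem_singleton_self v)
  · refine MeasurableSpace.generateFrom_le ?_
    rintro E ⟨A, hA, Q, S, hQ, hE⟩
    let _ : MeasurableSpace A := ⊤
    have hE' : E = (fun z => z ∈ E) ⁻¹' {True} := by ext; simp
    rw [hE']
    exact DeterminedBy.measurableSet_fiber (measurable_of_measurableSet_fiber hQ) hE True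

theorem measureDense_quantizedEvents : (iidUniform V).MeasureDense (quantizedEvents V) :=
  Measure.MeasureDense.of_generateFrom_isSetAlgebra_finite _ isSetAlgebra_quantizedEvents
    generateFrom_quantizedEvents

theorem exists_common_quantization {ι : Type*} (I : Finset ι) (E : ι → Set (V → unitInterval))
    (hE : ∀ i, E i ∈ quantizedEvents V) :
    ∃ (A : Type) (_ : Finite A) (Q : unitInterval → A) (S : Finset V),
      (∀ a, MeasurableSet (Q ⁻¹' {a})) ∧ ∀ i ∈ I, DeterminedBy Q S (· ∈ E i) := by
  classical
  induction I using Finset.induction_on with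
  | empty => exact ⟨Unit, inferInstance, fun _ => (), ∅, fun _ => by simp, by simp⟩
  | insert i I _ ih =>
    obtain ⟨A, hA, Q, S, hQ, h⟩ := ih
    obtain ⟨A', hA', Q', S', hQ', h'⟩ := hE i
    refine ⟨A × A', inferInstance, fun t => (Q t, Q' t), S ∪ S',
      measurableSet_fiber_prod hQ hQ', fun j hj z z' hz => ?_⟩
    rcases Finset.mem_insert.1 hj with rfl | hj
    · exact h' z z' fun w hw => (Prod.mk.inj (hz w (Finset.mem_union_right _ hw))).2
    · exact h j hj z z' fun w hw => (Prod.mk.inj (hz w (Finset.mem_union_left _ hw))).1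

variable {M : Type*} [Finite M]

theorem measurableSet_ne {Ω : Type*} [MeasurableSpace Ω] {X Y : Ω → M}
    (hX : ∀ m, MeasurableSet (X ⁻¹' {m})) (hY : ∀ m, MeasurableSet (Y ⁻¹' {m})) :
    MeasurableSet {z | X z ≠ Y z} := by
  have : {z | X z ≠ Y z} = (⋃ m, X ⁻¹' {m} ∩ Y ⁻¹' {m})ᶜ := by
    ext z; simp [eq_comm]
  rw [this]
  exact (MeasurableSet.iUnion fun m => (hX m).inter (hY m)).compl

/-- A random variable with finitely many values is approximated by functions of finitely many
quantized labels. -/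
theorem exists_determinedBy_approx [Nonempty M] {X : (V → unitInterval) → M}
    (hX : ∀ m, MeasurableSet (X ⁻¹' {m})) {ε : ℝ} (hε : 0 < ε) :
    ∃ (A : Type) (_ : Finite A) (Q : unitInterval → A) (S : Finset V)
      (G : (V → unitInterval) → M), (∀ a, MeasurableSet (Q ⁻¹' {a})) ∧ DeterminedBy Q S G ∧
      (iidUniform V).real {z | X z ≠ G z} < ε := by
  have := Fintype.ofFinite M
  have hc : (0 : ℝ) < Fintype.card M := by exact_mod_cast Fintype.card_pos
  choose E hE hEX using fun m => measureDense_quantizedEvents.approx (X ⁻¹' {m}) (hX m)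
    (measure_ne_top _ _) (ε / Fintype.card M) (by positivity)
  obtain ⟨A, hA, Q, S, hQ, hQE⟩ := exists_common_quantization Finset.univ E hE
  -- Choose some `m` with `z ∈ E m`, or a default value if there is none. An error puts `z` into one
  -- of the symmetric differences.
  refine ⟨A, hA, Q, S, fun z => Classical.epsilon fun m => z ∈ E m, hQ, fun z z' h => ?_, ?_⟩
  · have : (fun m => z ∈ E m) = fun m => z' ∈ E m :=
      funext fun m => hQE m (Finset.mem_univ m) z z' h
    simp only [this]
  · have hsub : {z | X z ≠ Classical.epsilon fun m => z ∈ E m} ⊆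
        ⋃ m ∈ (Finset.univ : Finset M), symmDiff (X ⁻¹' {m}) (E m) := by
      intro z hz
      by_contra hcon
      simp only [Finset.mem_univ, Set.iUnion_true, Set.mem_iUnion, not_exists,
        Set.mem_symmDiff, Set.mem_preimage, Set.mem_singleton_iff] at hcon
      have h : ∀ m, z ∈ E m ↔ X z = m := by
        intro m
        have := hcon m
        tauto
      have hs : Classical.epsilon (fun m => z ∈ E m) = X z := by
        have := Classical.epsilon_spec (p := fun m => z ∈ E m) ⟨X z, (h _).2 rfl⟩
        exact ((h _).1 this).symm
      exact hz hs.symm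
    calc (iidUniform V).real {z | X z ≠ Classical.epsilon fun m => z ∈ E m}
        ≤ (iidUniform V).real (⋃ m ∈ (Finset.univ : Finset M), symmDiff (X ⁻¹' {m}) (E m)) :=
          measureReal_mono hsub (measure_ne_top _ _)
      _ ≤ ∑ m, (iidUniform V).real (symmDiff (X ⁻¹' {m}) (E m)) :=
          measureReal_biUnion_finset_le _ _
      _ < ∑ _m : M, ε / Fintype.card M := by
          refine Finset.sum_lt_sum_of_nonempty Finset.univ_nonempty fun m _ => ?_
          rw [measureReal_def]
          exact (ENNReal.lt_ofReal_iff_toReal_lt (measure_ne_top _ _)).1 (hEX m)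
      _ = ε := by
          rw [Finset.sum_const, Finset.card_univ, nsmul_eq_mul]
          field_simp

/-- The chosen maximizer depends on the function `φ` alone, so ties in `bestGuess` are broken
equivariantly. -/
theorem exists_forall_le_apply [Nonempty M] (φ : M → ℝ) : ∃ m, ∀ m', φ m' ≤ φ m :=
  Finite.exists_max φ

/-- The most likely label of `v` given the quantized labels in the ball of radius `R`. -/
noncomputable def bestGuess {A : Type*} [Nonempty M] (T : SimpleGraph V) (Q : unitInterval → A)
    (R : ℕ) (F : (V → unitInterval) → V → M) (z : V → unitInterval) (v : V) : M :=
  (exists_forall_le_apply fun m => (iidUniform V).real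
    {z' | F z' v = m ∧ ∀ w ∈ cball T v R, Q (z' w) = Q (z w)}).choose

variable {A : Type*} {T : SimpleGraph V} [Nonempty M] {Q : unitInterval → A}
  {F : (V → unitInterval) → V → M}

theorem bestGuess_spec (R : ℕ) (z : V → unitInterval) (v : V) (m : M) :
    (iidUniform V).real {z' | F z' v = m ∧ ∀ w ∈ cball T v R, Q (z' w) = Q (z w)} ≤
      (iidUniform V).real {z' | F z' v = bestGuess T Q R F z v ∧
        ∀ w ∈ cball T v R, Q (z' w) = Q (z w)} :=
  (exists_forall_le_apply fun m => (iidUniform V).real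
    {z' | F z' v = m ∧ ∀ w ∈ cball T v R, Q (z' w) = Q (z w)}).choose_spec m

variable [T.LocallyFinite]

theorem isBlockFactor_bestGuess [Finite A] (hc : T.Connected) (hQ : ∀ a, MeasurableSet (Q ⁻¹' {a}))
    (hF : ∀ v m, MeasurableSet ((fun z => F z v) ⁻¹' {m}))
    (hequiv : ∀ (γ : T ≃g T) (z : V → unitInterval), F (autAct γ z) = autAct γ (F z)) (R : ℕ) :
    IsBlockFactor T Q R (bestGuess T Q R F) where
  determined v z z' h := by
    have e : ∀ z₁ : V → unitInterval, (∀ w ∈ cball T v R, Q (z₁ w) = Q (z w)) ↔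
        ∀ w ∈ cball T v R, Q (z₁ w) = Q (z' w) :=
      fun z₁ => forall₂_congr fun w hw => by rw [h w hw]
    simp only [bestGuess, e]
  equivariant γ z := by
    let _ : MeasurableSpace A := ⊤
    funext v
    obtain ⟨v, rfl⟩ := γ.surjective v
    rw [autAct, RelIso.symm_apply_apply]
    have e : ∀ m, (iidUniform V).real {z' | F z' (γ v) = m ∧
        ∀ w ∈ cball T (γ v) R, Q (z' w) = Q (autAct γ z w)} =
        (iidUniform V).real {z' | F z' v = m ∧ ∀ w ∈ cball T v R, Q (z' w) = Q (z w)} := by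
      intro m
      have hm : MeasurableSet {z' | F z' (γ v) = m ∧
          ∀ w ∈ cball T (γ v) R, Q (z' w) = Q (autAct γ z w)} := by
        have h1 : {z' : V → unitInterval | F z' (γ v) = m ∧
            ∀ w ∈ cball T (γ v) R, Q (z' w) = Q (autAct γ z w)} =
            (fun z => F z (γ v)) ⁻¹' {m} ∩
              obs Q (cball T (γ v) R) ⁻¹' {obs Q (cball T (γ v) R) (autAct γ z)} := by
          ext z'
          simp [obs_eq_iff]
        rw [h1]
        exact (hF _ m).inter ((determinedBy_obs Q _).measurableSet_fiber
          (measurable_of_measurableSet_fiber hQ) _)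
      rw [← (measurePreserving_autAct γ).measureReal_preimage hm.nullMeasurableSet]
      congr 1
      ext z'
      simp only [Set.mem_preimage, Set.mem_ofPred_eq, hequiv, cball_map hc, Finset.mem_map,
        forall_exists_index, and_imp, forall_apply_eq_imp_iff₂]
      simp [autAct]
    simp only [bestGuess, e]

/-- `G` need not be invariant under automorphisms fixing `v`, so it cannot simply be copied to other
vertices. The most likely label is canonical, and it is correct with at least as much probability as
`G` on each fiber of the observed labels. -/
theorem measureReal_ne_bestGuess_le [Finite A] (hQ : ∀ a, MeasurableSet (Q ⁻¹' {a}))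
    (hc : T.Connected) (hF : ∀ v m, MeasurableSet ((fun z => F z v) ⁻¹' {m}))
    (hequiv : ∀ (γ : T ≃g T) (z : V → unitInterval), F (autAct γ z) = autAct γ (F z))
    {R : ℕ} {v : V} {G : (V → unitInterval) → M} (hG : DeterminedBy Q (cball T v R) G) :
    (iidUniform V).real {z | F z v ≠ bestGuess T Q R F z v} ≤
      (iidUniform V).real {z | F z v ≠ G z} := by
  let _ : MeasurableSpace A := ⊤
  have := Fintype.ofFinite (cball T v R → A)
  have hQm := measurable_of_measurableSet_fiber hQ
  have hY := isBlockFactor_bestGuess hc hQ hF hequiv R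
  have m1 := measurableSet_ne (hF v) ((hY.determined v).measurableSet_fiber hQm)
  have m2 := measurableSet_ne (hF v) (hG.measurableSet_fiber hQm)
  have key : (iidUniform V).real {z | F z v ≠ G z}ᶜ ≤
      (iidUniform V).real {z | F z v ≠ bestGuess T Q R F z v}ᶜ := by
    have ho := (determinedBy_obs Q (cball T v R)).measurableSet_fiber hQm
    rw [← sum_measureReal_fiber ho, ← sum_measureReal_fiber ho]
    refine Finset.sum_le_sum fun c _ => ?_
    rcases Set.eq_empty_or_nonempty (obs Q (cball T v R) ⁻¹' {c}) with h0 | ⟨z, rfl⟩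
    · rw [h0]; simp
    · have hb := bestGuess_spec (T := T) (Q := Q) (F := F) R z v (G z)
      refine le_trans (le_of_eq ?_) (hb.trans (le_of_eq ?_))
      · congr 1
        ext z'
        simp only [Set.mem_inter_iff, Set.mem_preimage, Set.mem_singleton_iff, obs_eq_iff,
          Set.mem_compl_iff, Set.mem_ofPred_eq, not_not]
        rw [and_comm]
        refine and_congr_left fun h => ?_
        rw [hG z' z h]
      · congr 1
        ext z'
        simp only [Set.mem_inter_iff, Set.mem_preimage, Set.mem_singleton_iff, obs_eq_iff,
          Set.mem_compl_iff, Set.mem_ofPred_eq, not_not]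
        rw [and_comm (b := F z' v = _)]
        refine and_congr_left fun h => ?_
        exact Eq.congr_right (hY.determined v z' z h).symm
  rw [probReal_compl_eq_one_sub m1, probReal_compl_eq_one_sub m2] at key
  linarith

/-- Factors of IID are limits of block factors. -/
theorem exists_isBlockFactor_approx (hT : T.IsTree) {d : ℕ} (hreg : T.IsRegularOfDegree d)
    (hF : ∀ v m, MeasurableSet ((fun z => F z v) ⁻¹' {m}))
    (hequiv : ∀ (γ : T ≃g T) (z : V → unitInterval), F (autAct γ z) = autAct γ (F z))
    {ε : ℝ} (hε : 0 < ε) :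
    ∃ (A : Type) (_ : Finite A) (Q : unitInterval → A) (R : ℕ) (Y : (V → unitInterval) → V → M),
      (∀ a, MeasurableSet (Q ⁻¹' {a})) ∧ IsBlockFactor T Q R Y ∧
      ∀ v, (iidUniform V).real {z | F z v ≠ Y z v} < ε := by
  have hc := hT.1
  obtain ⟨u⟩ := hc.nonempty
  obtain ⟨A, hA, Q, S, G, hQ, hG, hGε⟩ := exists_determinedBy_approx (hF u) hε
  let _ : MeasurableSpace A := ⊤
  have hGR : DeterminedBy Q (cball T u (S.sup (T.dist u))) G := hG.mono fun w hw =>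
    (mem_cball hc).2 (Finset.le_sup (f := T.dist u) hw)
  have hY := isBlockFactor_bestGuess hc hQ hF hequiv (S.sup (T.dist u))
  refine ⟨A, hA, Q, S.sup (T.dist u), _, hQ, hY, fun v => ?_⟩
  refine lt_of_le_of_lt ?_ hGε
  refine le_trans (le_of_eq ?_) (measureReal_ne_bestGuess_le hQ hc hF hequiv hGR)
  obtain ⟨γ, rfl, -⟩ := exists_aut_of_dist_eq hT hreg (x := u) (y := u) (x' := v) (y' := v)
    (by simp)
  have hm := measurableSet_ne (hF (γ u)) ((hY.determined (γ u)).measurableSet_fiber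
    (measurable_of_measurableSet_fiber hQ))
  rw [← (measurePreserving_autAct γ).measureReal_preimage hm.nullMeasurableSet]
  congr 1
  ext z
  simp only [Set.mem_preimage, Set.mem_ofPred_eq, hequiv, hY.equivariant]
  simp [autAct]

end Approximation

/-! ### Passage to the limit and the final bounds. -/

section Main

/-- Each fiber probability moves by at most the probability of disagreement, and `Real.negMulLog` is
continuous. -/
theorem tendsto_fiberEntropy {Ω S : Type*} [MeasurableSpace Ω] {μ : Measure Ω}
    [IsProbabilityMeasure μ] [Finite S] {X : Ω → S} {Y : ℕ → Ω → S}
    (hX : ∀ s, MeasurableSet (X ⁻¹' {s})) (hY : ∀ n s, MeasurableSet (Y n ⁻¹' {s}))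
    (h : Filter.Tendsto (fun n => μ.real {ω | X ω ≠ Y n ω}) Filter.atTop (nhds 0)) :
    Filter.Tendsto (fun n => fiberEntropy μ (Y n)) Filter.atTop (nhds (fiberEntropy μ X)) := by
  have := Fintype.ofFinite S
  simp only [fiberEntropy_eq_sum]
  refine tendsto_finsetSum _ fun s _ => ?_
  refine (Real.continuous_negMulLog.tendsto _).comp ?_
  rw [tendsto_iff_dist_tendsto_zero]
  refine squeeze_zero (fun _ => dist_nonneg) (fun n => ?_) h
  rw [Real.dist_eq]
  refine (abs_measureReal_sub_le_measureReal_symmDiff (hY n s).nullMeasurableSet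
    (hX s).nullMeasurableSet).trans (measureReal_mono ?_ (measure_ne_top _ _))
  intro ω hω
  simp only [Set.mem_symmDiff, Set.mem_preimage, Set.mem_singleton_iff] at hω
  simp only [Set.mem_ofPred_eq]
  rintro h
  rw [h] at hω
  tauto

variable {V M : Type*} {T : SimpleGraph V}

variable {Ω : Type*} [MeasurableSpace Ω] [MeasurableSpace M]

/-- Entropies of a random labeling can be computed on the space of the IID labels. -/
theorem entropy_eq_of_hasLaw {S : Type*} [Fintype S] [MeasurableSpace S]
    [MeasurableSingletonClass S] {P : Measure Ω} {Y : Ω → V → M}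
    {F : (V → unitInterval) → V → M} (hF : Measurable F)
    (hY : HasLaw Y ((iidUniform V).map F) P) {g : (V → M) → S} (hg : Measurable g) :
    entropy P (fun ω => g (Y ω)) = fiberEntropy (iidUniform V) (fun z => g (F z)) := by
  have h : P.map (fun ω => g (Y ω)) = (iidUniform V).map (fun z => g (F z)) := by
    have h1 := AEMeasurable.map_map_of_aemeasurable hg.aemeasurable hY.aemeasurable
    have h2 := Measure.map_map (μ := iidUniform V) hg hF
    rw [hY.map_eq] at h1
    exact h1.symm.trans h2
  have h' := entropy_eq_fiberEntropy (μ := iidUniform V) (hg.comp hF)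
  rw [entropy] at h' ⊢
  rw [h]
  exact h'

theorem mutualInfo_self_of_isAutFactorOfIID [Fintype M] [DiscreteMeasurableSpace M]
    {P : Measure Ω} {Y : Ω → V → M}
    (hY : IsAutFactorOfIID T P Y) (v : V) :
    mutualInfo P (fun ω => Y ω v) (fun ω => Y ω v) = entropy P (fun ω => Y ω v) := by
  obtain ⟨F, hF, hlaw⟩ := hY
  have h1 : entropy P (fun ω => Y ω v) = fiberEntropy (iidUniform V) (fun z => F z v) :=
    entropy_eq_of_hasLaw hF.measurable hlaw (measurable_pi_apply v)
  have h2 : entropy P (fun ω => (Y ω v, Y ω v)) =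
      fiberEntropy (iidUniform V) (fun z => (F z v, F z v)) :=
    entropy_eq_of_hasLaw hF.measurable hlaw
      ((measurable_pi_apply v).prodMk (measurable_pi_apply v))
  have h3 : fiberEntropy (iidUniform V) (fun z => (F z v, F z v)) =
      fiberEntropy (iidUniform V) (fun z => F z v) := fiberEntropy_congr fun z z' => by simp
  rw [mutualInfo, h2, h3, ← h1]
  ring

theorem entropy_nonneg {S : Type*} [Fintype S] [MeasurableSpace S] (P : Measure Ω)
    [IsProbabilityMeasure P] (X : Ω → S) : 0 ≤ entropy P X := by
  refine Finset.sum_nonneg fun s _ => Real.negMulLog_nonneg measureReal_nonneg ?_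
  by_cases hX : AEMeasurable X P
  · have := Measure.isProbabilityMeasure_map hX
    exact measureReal_le_one
  · rw [Measure.map_of_not_aemeasurable hX]
    simp

theorem div_le_div_of_mul_le {a b x y : ℝ} (hb : 0 < b) (ha : 0 ≤ a) (hy : 0 ≤ y)
    (h : b * x ≤ a * y) : x / y ≤ a / b := by
  rcases hy.eq_or_lt with rfl | hy
  · rw [div_zero]; positivity
  · rw [div_le_div_iff₀ hy hb]; linarith

variable [T.LocallyFinite]

/-- The entropy inequality for factors of IID. -/
theorem factor_entropy_inequality {M : Type*} [Finite M] [Nonempty M] (hT : T.IsTree) {d : ℕ}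
    (hreg : T.IsRegularOfDegree d) {F : (V → unitInterval) → V → M}
    (hF : ∀ v m, MeasurableSet ((fun z => F z v) ⁻¹' {m}))
    (hequiv : ∀ (γ : T ≃g T) (z : V → unitInterval), F (autAct γ z) = autAct γ (F z))
    {k N : ℕ} (hN : ∀ o x, descentCount T o x (k + 1) ≤ N) {u v : V}
    (huv : T.dist u v = k + 1) :
    (2 * (d * (d - 1 : ℕ) ^ k) - N) * fiberEntropy (iidUniform V) (fun z => F z u) ≤
      (d * (d - 1 : ℕ) ^ k) * fiberEntropy (iidUniform V) (fun z => (F z u, F z v)) := by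
  choose A hA Q R Y hQ hY hYε using fun n : ℕ =>
    exists_isBlockFactor_approx hT hreg hF hequiv (Nat.one_div_pos_of_nat (α := ℝ) (n := n))
  have hYm : ∀ n v m, MeasurableSet ((fun z => Y n z v) ⁻¹' {m}) := by
    intro n v m
    let _ : MeasurableSpace (A n) := ⊤
    exact ((hY n).determined v).measurableSet_fiber (measurable_of_measurableSet_fiber (hQ n)) m
  have lim : ∀ v, Filter.Tendsto (fun n => (iidUniform V).real {z | F z v ≠ Y n z v})
      Filter.atTop (nhds 0) := fun v =>
    squeeze_zero (fun _ => measureReal_nonneg) (fun n => (hYε n v).le)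
      tendsto_one_div_add_atTop_nhds_zero_nat
  have l1 := tendsto_fiberEntropy (hF u) (fun n => hYm n u) (lim u)
  have l2 := tendsto_fiberEntropy (μ := iidUniform V) (measurableSet_fiber_prod (hF u) (hF v))
    (fun n => measurableSet_fiber_prod (hYm n u) (hYm n v)) (by
      have h := (lim u).add (lim v)
      rw [add_zero] at h
      refine squeeze_zero (fun _ => measureReal_nonneg) (fun n => ?_) h
      refine (measureReal_mono ?_ (measure_ne_top _ _)).trans (measureReal_union_le _ _)
      intro z hz
      simp only [ne_eq, Prod.mk.injEq, Set.mem_ofPred_eq, Set.mem_union] at hz ⊢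
      tauto)
  refine le_of_tendsto_of_tendsto' (l1.const_mul _) (l2.const_mul _) fun n => ?_
  let _ : MeasurableSpace (A n) := ⊤
  exact (hY n).entropy_inequality hT hreg (measurable_of_measurableSet_fiber (hQ n)) hN huv

theorem mutualInfo_le_of_descentCount_le [Fintype M] [DiscreteMeasurableSpace M] (hT : T.IsTree) {d : ℕ}
    (hreg : T.IsRegularOfDegree d) {P : Measure Ω} [IsProbabilityMeasure P] {Y : Ω → V → M}
    (hY : IsAutFactorOfIID T P Y) {k N : ℕ} (hN : ∀ o x, descentCount T o x (k + 1) ≤ N)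
    {u v : V} (huv : T.dist u v = k + 1) :
    (d * (d - 1 : ℕ) ^ k) * mutualInfo P (fun ω => Y ω u) (fun ω => Y ω v) ≤
      N * entropy P (fun ω => Y ω v) := by
  obtain ⟨F, hF, hlaw⟩ := hY
  have hM : Nonempty M := by
    obtain ⟨ω⟩ : Nonempty Ω := P.nonempty_of_neZero
    exact ⟨Y ω u⟩
  have hFm : ∀ v m, MeasurableSet ((fun z => F z v) ⁻¹' {m}) := fun v m =>
    ((measurable_pi_apply v).comp hF.measurable) (measurableSet_singleton m)
  have key := factor_entropy_inequality hT hreg hFm hF.equivariant hN huv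
  have e : ∀ x, entropy P (fun ω => Y ω x) = fiberEntropy (iidUniform V) (fun z => F z x) :=
    fun x => entropy_eq_of_hasLaw hF.measurable hlaw (measurable_pi_apply x)
  have e2 : entropy P (fun ω => (Y ω u, Y ω v)) =
      fiberEntropy (iidUniform V) (fun z => (F z u, F z v)) :=
    entropy_eq_of_hasLaw hF.measurable hlaw
      ((measurable_pi_apply u).prodMk (measurable_pi_apply v))
  have huv' : fiberEntropy (iidUniform V) (fun z => F z u) =
      fiberEntropy (iidUniform V) (fun z => F z v) := by
    obtain ⟨γ, rfl, -⟩ := exists_aut_of_dist_eq hT hreg (x := v) (y := v) (x' := u) (y' := u)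
      (by simp)
    rw [← fiberEntropy_comp (measurePreserving_autAct γ) (hFm (γ v))]
    simp only [Function.comp_def, hF.equivariant, autAct, RelIso.symm_apply_apply]
  rw [mutualInfo, e, e, e2, ← huv']
  linarith

end Main

end FactorIID

theorem mainTheorem6 {V Ω M : Type*} [MeasurableSpace Ω]
    [Fintype M] [MeasurableSpace M] [DiscreteMeasurableSpace M]
    (d : ℕ) (hd : 3 ≤ d)
    (T : SimpleGraph V) [T.LocallyFinite] (hT : T.IsTree) (hreg : T.IsRegularOfDegree d)
    (P : Measure Ω) [IsProbabilityMeasure P]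
    (Y : Ω → V → M) (hY : FactorIID.IsAutFactorOfIID T P Y) (u v : V) (l : ℕ) :
    (T.dist u v = 2 * l + 1 →
      FactorIID.mutualInfo P (fun ω => Y ω u) (fun ω => Y ω v) /
          FactorIID.entropy P (fun ω => Y ω v) ≤
        2 / ((d : ℝ) * ((d : ℝ) - 1) ^ l)) ∧
    (T.dist u v = 2 * l →
      FactorIID.mutualInfo P (fun ω => Y ω u) (fun ω => Y ω v) /
          FactorIID.entropy P (fun ω => Y ω v) ≤
        1 / ((d : ℝ) - 1) ^ l) := by
  have hH := FactorIID.entropy_nonneg P (fun ω => Y ω v)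
  -- With `q = d - 1` natural and real subtraction agree.
  obtain ⟨q, rfl⟩ : ∃ q, d = q + 1 := ⟨d - 1, by omega⟩
  have hq : (0 : ℝ) < q := by exact_mod_cast (by omega : 0 < q)
  constructor
  · intro h
    have key := FactorIID.mutualInfo_le_of_descentCount_le hT hreg hY
      (fun o x => FactorIID.descentCount_odd_le hT hreg o x l) h
    simp only [Nat.add_sub_cancel] at key
    push_cast at key ⊢
    rw [add_sub_cancel_right]
    refine FactorIID.div_le_div_of_mul_le (by positivity) (by norm_num) hH ?_
    -- Here `N = 2 q ^ l` and the sphere has `(q + 1) q ^ (2 l)` vertices; a factor `q ^ l` cancels.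
    refine le_of_mul_le_mul_left ?_ (pow_pos hq l)
    have e : (q : ℝ) ^ (2 * l) = q ^ l * q ^ l := by rw [two_mul, pow_add]
    rw [e] at key
    linarith
  · intro h
    rcases l with _ | l
    · obtain rfl := hT.1.dist_eq_zero_iff.1 h
      rw [FactorIID.mutualInfo_self_of_isAutFactorOfIID hY]
      simpa using div_self_le_one _
    · have key := FactorIID.mutualInfo_le_of_descentCount_le (k := 2 * l + 1) hT hreg hY
        (fun o x => FactorIID.descentCount_even_le hT hreg o x l) (h.trans (by ring))
      simp only [Nat.add_sub_cancel] at key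
      push_cast at key ⊢
      rw [add_sub_cancel_right]
      refine FactorIID.div_le_div_of_mul_le (by positivity) zero_le_one hH ?_
      -- `N = q ^ (l + 1) + q ^ l = (q + 1) q ^ l` divides the sphere size `(q + 1) q ^ (2 l + 1)`,
      -- leaving `q ^ (l + 1)`.
      have hpos : (0 : ℝ) < (q + 1) * q ^ l := by positivity
      refine le_of_mul_le_mul_left ?_ hpos
      have e : (q : ℝ) ^ (2 * l + 1) = q ^ l * q ^ (l + 1) := by rw [← pow_add]; ring
      have e' : (q : ℝ) ^ (l + 1) + q ^ l = (q + 1) * q ^ l := by ring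
      rw [e, e'] at key
      linarith
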